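/- **Setting.** A *process theory* is a strict symmetric monoidal category (objects: systems; morphisms: processes); a *diagram-preserving* map is a strict symmetric monoidal functor. $\mathrm{Proc}$ is the free process theory on a collection of elementary systems and elementary laboratory procedures; some of the elementary systems are classical, each with a set of states. $\mathrm{Func}$ is the process theory of functions between finite sets. $\mathrm{SubStoch}$ is the process theory of substochastic maps between sets (each column a finitely supported subprobability distribution); a substochastic map is *stochastic* if every column sums to $1$. **The two theories.** Let $\mathcal C$ be $\mathrm{Proc}$ or $\mathrm{Func}$. The causal-inferential theory over $\mathcal C$ ($\textsc{P-S}$ for $\mathcal C=\mathrm{Proc}$, $\textsc{F-S}$ for $\mathcal C=\mathrm{Func}$) has as systems pairs of an inferential system $X$ (a set) and a causal system $A$ of $\mathcal C$. Its processes are the diagrams generated by * substochastic maps between inferential systems; * for all causal systems $A,B$, a process $\kappa_{A,B}$ from the inferential system $\mathcal C(A,B)$ next to the causal system $A$ to the causal system $B$ (specifying a state of knowledge about the process from $A$ to $B$); * gaining knowledge $\ell_C : C\to \mathrm{val}(C)\otimes C$, where $\mathrm{val}(C)$ is the inferential system formed by the set of values of $C$, for every composite $C$ of classical systems if $\mathcal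 C=\mathrm{Proc}$, and for every system if $\mathcal C=\mathrm{Func}$; * ignoring $\top_A : A\to 1$, for every causal system $A$, modulo the following rules. (a) Substochastic maps compose as in $\mathrm{SubStoch}$. (b) $\kappa$ is compatible with composition: two sequential (parallel) $\kappa$'s equal one $\kappa$ preceded by the deterministic map $(f,g)\mapsto g\circ f$ (respectively $(f,g)\mapsto f\otimes g$); and $\kappa$ applied to the point distribution on the identity or the swap of $\mathcal C$ is the identity or the swap of causal systems. (c) $\ell_C$ followed by marginalizing $\mathrm{val}(C)$ is the identity; applying $\ell_C$ twice equals $\ell_C$ followed by copying the value; $\ell_{C\otimes C'}=\ell_C\otimes \ell_{C'}$. (d) $\top_1$ is the identity, $\top_{A\otimes B}=\top_A\otimes\top_B$, and $\kappa_{A,B}$ followed by $\top_B$ equals marginalizing $\mathcal C(A,B)$ and applying $\top_A$. (e) In $\textsc{F-S}$ only: $\ell_M\circ\kappa_{\Lambda,M}$ equals the process that applies $\ell_\Lambda$, obtaining $\lambda$, maps $(f,\lambda)\mapsto (f(\lambda),f)$, outputs $f(\lambda)$, and applies $\kappa_{\Lambda,M}$ to $f$ and $\Lambda$. **Predictions and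 quotients.** A *prediction map* for such a theory is a diagram-preserving map to $\mathrm{SubStoch}$, defined on the processes without causal inputs or outputs, that sends every generating substochastic map to itself. Fix prediction maps $\mathbf p$ of $\textsc{P-S}$ and $\mathbf p^*$ of $\textsc{F-S}$. Two processes with the same inputs and outputs are *inferentially equivalent* if inserting either one in any diagram that has no open causal systems (possibly with an auxiliary system alongside) gives the same predictions. $\widetilde{\textsc{P-S}}$ and $\widetilde{\textsc{F-S}}$ are the quotients by inferential equivalence, with the induced prediction maps $\tilde{\mathbf p}$, $\tilde{\mathbf p}^*$. A *classical realist representation* of $\widetilde{\textsc{P-S}}$ by $\widetilde{\textsc{F-S}}$ is a diagram-preserving map $\tilde\xi:\widetilde{\textsc{P-S}}\to\widetilde{\textsc{F-S}}$ that sends each causal system $A$ to a causal system $\Lambda_A$ and processes without causal inputs or outputs to such processes, and that satisfies (i) preservation of predictions, $\tilde{\mathbf p}^*\circ\tilde\xi=\tilde{\mathbf p}$ on processes without causal inputs or outputs, and (ii) preservation of ignorability, $\tilde\xi(\top_A)=\top_{\Lambda_A}$ for every causal system $A$. **Proposition.** Let $\tilde\xi$ be a classical realist representation of $\widetilde{\textsc{P-S}}$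 by $\widetilde{\textsc{F-S}}$. Then for all causal systems $A,B$ there is a stochastic map $$\Xi_A^B:\ \mathrm{Proc}(A,B)\to \mathrm{Func}(\Lambda_A,\Lambda_B),$$ from states of knowledge about laboratory procedures to states of knowledge about functional dynamics, such that $$\tilde\xi(\kappa_{A,B})\;=\;\kappa_{\Lambda_A,\Lambda_B}\circ\bigl(\Xi_A^B\otimes \mathrm{id}_{\Lambda_A}\bigr)$$ holds exactly in $\widetilde{\textsc{F-S}}$. -/

import Mathlib

open scoped NNReal

noncomputable section

universe s s' s'' h h' h'' u

namespace CausalInferential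

/-! ## Process theories and diagram-preserving maps -/

/-- Transport of a process along equalities of its input and output systems. -/
def castHom {S : Type s} {P : S → S → Type h} {a b a' b' : S} (ha : a = a') (hb : b = b')
    (f : P a b) : P a' b' := by
  subst ha hb
  exact f

@[simp] theorem castHom_rfl {S : Type s} {P : S → S → Type h} {a b : S} (ha : a = a) (hb : b = b)
    (f : P a b) : castHom ha hb f = f := rfl

theorem castHom_heq {S : Type s} {P : S → S → Type h} {a b a' b' : S} (ha : a = a') (hb : b = b')
    (f : P a b) : HEq (castHom ha hb f) f := by
  subst ha hb
  rfl

/-- A process theory: a strict symmetric monoidal category. Systems form a monoid under parallel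
composition (the unit is the trivial system); `comp f g` is the diagram "first `f`, then `g`";
`par f g` is "`f` next to `g`". Laws relating processes whose types agree only because systems
form a monoid are stated with `HEq`. -/
structure ProcessTheory where
  Sys : Type s
  [mon : Monoid Sys]
  Proc : Sys → Sys → Type h
  id : ∀ a, Proc a a
  comp : ∀ {a b c}, Proc a b → Proc b c → Proc a c
  par : ∀ {a b c d}, Proc a b → Proc c d → Proc (a * c) (b * d)
  swap : ∀ a b, Proc (a * b) (b * a)
  id_comp : ∀ {a b} (f : Proc a b), comp (id a) f = f
  comp_id : ∀ {a b} (f : Proc a b), comp f (id b) = f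
  assoc : ∀ {a b c d} (f : Proc a b) (g : Proc b c) (k : Proc c d),
    comp (comp f g) k = comp f (comp g k)
  par_id : ∀ a b, par (id a) (id b) = id (a * b)
  par_comp : ∀ {a b c a' b' c'} (f : Proc a b) (g : Proc b c) (f' : Proc a' b') (g' : Proc b' c'),
    par (comp f g) (comp f' g') = comp (par f f') (par g g')
  par_assoc : ∀ {a b c d e k} (f : Proc a b) (g : Proc c d) (l : Proc e k),
    HEq (par (par f g) l) (par f (par g l))
  one_par : ∀ {a b} (f : Proc a b), HEq (par (id 1) f) f
  par_one : ∀ {a b} (f : Proc a b), HEq (par f (id 1)) f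
  swap_nat : ∀ {a b c d} (f : Proc a b) (g : Proc c d),
    comp (par f g) (swap b d) = comp (swap a c) (par g f)
  swap_swap : ∀ a b, comp (swap a b) (swap b a) = id (a * b)
  hexagon : ∀ a b c, HEq (swap a (b * c))
    (comp (castHom (mul_assoc a b c) (mul_assoc b a c) (par (swap a b) (id c)))
      (par (id b) (swap a c)))

attribute [instance] ProcessTheory.mon

namespace ProcessTheory

/-- The full sub-process-theory on a set of systems closed under parallel composition. -/
def full (T : ProcessTheory.{s, h}) (S : Submonoid T.Sys) : ProcessTheory.{s, h} where
  Sys := S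
  Proc a b := T.Proc a b
  id a := T.id a
  comp f g := T.comp f g
  par f g := T.par f g
  swap a b := T.swap a b
  id_comp f := T.id_comp f
  comp_id f := T.comp_id f
  assoc f g k := T.assoc f g k
  par_id a b := T.par_id a b
  par_comp f g f' g' := T.par_comp f g f' g'
  par_assoc f g l := T.par_assoc f g l
  one_par f := T.one_par f
  par_one f := T.par_one f
  swap_nat f g := T.swap_nat f g
  swap_swap a b := T.swap_swap a b
  hexagon a b c := by
    refine (T.hexagon a b c).trans (heq_of_eq ?_)
    congr 1
    apply eq_of_heq
    refine (castHom_heq _ _ _).trans ?_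
    exact (castHom_heq (P := fun x y : S => T.Proc x y)
      (mul_assoc a b c) (mul_assoc b a c) _).symm

end ProcessTheory

/-- A diagram-preserving map: a strict symmetric monoidal functor. -/
@[ext] structure DPMap (T : ProcessTheory.{s, h}) (U : ProcessTheory.{s', h'}) where
  obj : T.Sys →* U.Sys
  map : ∀ {a b}, T.Proc a b → U.Proc (obj a) (obj b)
  map_id : ∀ a, map (T.id a) = U.id (obj a)
  map_comp : ∀ {a b c} (f : T.Proc a b) (g : T.Proc b c),
    map (T.comp f g) = U.comp (map f) (map g)
  map_par : ∀ {a b c d} (f : T.Proc a b) (g : T.Proc c d),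
    HEq (map (T.par f g)) (U.par (map f) (map g))
  map_swap : ∀ a b, HEq (map (T.swap a b)) (U.swap (obj a) (obj b))

namespace DPMap

/-- The identity diagram-preserving map. -/
def id (T : ProcessTheory.{s, h}) : DPMap T T where
  obj := MonoidHom.id _
  map f := f
  map_id _ := rfl
  map_comp _ _ := rfl
  map_par _ _ := HEq.rfl
  map_swap _ _ := HEq.rfl

theorem map_heq {T : ProcessTheory.{s, h}} {U : ProcessTheory.{s', h'}} (F : DPMap T U)
    {a b a' b' : T.Sys} (ha : a = a') (hb : b = b') {f : T.Proc a b} {g : T.Proc a' b'}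
    (hfg : HEq f g) : HEq (F.map f) (F.map g) := by
  subst ha hb
  rw [eq_of_heq hfg]

/-- Composition of diagram-preserving maps: `G.comp F` is `F` followed by `G`. -/
def comp {T : ProcessTheory.{s, h}} {U : ProcessTheory.{s', h'}} {V : ProcessTheory.{s'', h''}}
    (G : DPMap U V) (F : DPMap T U) : DPMap T V where
  obj := G.obj.comp F.obj
  map f := G.map (F.map f)
  map_id a := by rw [F.map_id, G.map_id]; rfl
  map_comp f g := by rw [F.map_comp, G.map_comp]
  map_par f g := (G.map_heq (map_mul F.obj _ _) (map_mul F.obj _ _) (F.map_par f g)).trans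
    (G.map_par _ _)
  map_swap a b := (G.map_heq (map_mul F.obj _ _) (map_mul F.obj _ _) (F.map_swap a b)).trans
    (G.map_swap _ _)

/-- Restriction of a diagram-preserving map to full sub-process-theories. -/
def restrict {T : ProcessTheory.{s, h}} {U : ProcessTheory.{s', h'}} (F : DPMap T U)
    (S : Submonoid T.Sys) (S' : Submonoid U.Sys) (hS : ∀ a ∈ S, F.obj a ∈ S') :
    DPMap (T.full S) (U.full S') where
  obj := (F.obj.comp S.subtype).codRestrict S' fun a : S => hS a a.2
  map f := F.map f
  map_id a := F.map_id a.1
  map_comp f g := F.map_comp f g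
  map_par f g := F.map_par f g
  map_swap a b := F.map_swap a.1 b.1

end DPMap

/-! ## Process theories presented by generators and rewrite rules -/

/-- Formal diagrams built from a family `G` of generating processes. -/
inductive Term {S : Type s} [Monoid S] (G : S → S → Type h) : S → S → Type (max s h)
  | gen {a b : S} (g : G a b) : Term G a b
  | id (a : S) : Term G a a
  | comp {a b c : S} (f : Term G a b) (g : Term G b c) : Term G a c
  | par {a b c d : S} (f : Term G a b) (g : Term G c d) : Term G (a * c) (b * d)
  | swap (a b : S) : Term G (a * b) (b * a)

/-- Equality of diagrams, modulo the rewrite rules `R`: the least congruence containing `R` and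
the laws of a strict symmetric monoidal category. -/
inductive Rel {S : Type s} [Monoid S] {G : S → S → Type h}
    (R : ∀ {a b : S}, Term G a b → Term G a b → Prop) :
    ∀ {a b : S}, Term G a b → Term G a b → Prop
  | of {a b : S} {f g : Term G a b} : R f g → Rel R f g
  | refl {a b : S} (f : Term G a b) : Rel R f f
  | symm {a b : S} {f g : Term G a b} : Rel R f g → Rel R g f
  | trans {a b : S} {f g k : Term G a b} : Rel R f g → Rel R g k → Rel R f k
  | comp {a b c : S} {f f' : Term G a b} {g g' : Term G b c} :
      Rel R f f' → Rel R g g' → Rel R (f.comp g) (f'.comp g')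
  | par {a b c d : S} {f f' : Term G a b} {g g' : Term G c d} :
      Rel R f f' → Rel R g g' → Rel R (f.par g) (f'.par g')
  | id_comp {a b : S} (f : Term G a b) : Rel R ((Term.id a).comp f) f
  | comp_id {a b : S} (f : Term G a b) : Rel R (f.comp (Term.id b)) f
  | assoc {a b c d : S} (f : Term G a b) (g : Term G b c) (k : Term G c d) :
      Rel R ((f.comp g).comp k) (f.comp (g.comp k))
  | par_id (a b : S) : Rel R ((Term.id a).par (Term.id b)) (Term.id (a * b))
  | par_comp {a b c a' b' c' : S} (f : Term G a b) (g : Term G b c) (f' : Term G a' b')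
      (g' : Term G b' c') :
      Rel R ((f.comp g).par (f'.comp g')) ((f.par f').comp (g.par g'))
  | par_assoc {a b c d e k : S} (f : Term G a b) (g : Term G c d) (l : Term G e k) :
      Rel R (castHom (mul_assoc a c e) (mul_assoc b d k) ((f.par g).par l)) (f.par (g.par l))
  | one_par {a b : S} (f : Term G a b) :
      Rel R (castHom (one_mul a) (one_mul b) ((Term.id 1).par f)) f
  | par_one {a b : S} (f : Term G a b) :
      Rel R (castHom (mul_one a) (mul_one b) (f.par (Term.id 1))) f
  | swap_nat {a b c d : S} (f : Term G a b) (g : Term G c d) :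
      Rel R ((f.par g).comp (Term.swap b d)) ((Term.swap a c).comp (g.par f))
  | swap_swap (a b : S) : Rel R ((Term.swap a b).comp (Term.swap b a)) (Term.id (a * b))
  | hexagon (a b c : S) :
      Rel R (castHom rfl (mul_assoc b c a) (Term.swap a (b * c)))
        ((castHom (mul_assoc a b c) (mul_assoc b a c) ((Term.swap a b).par (Term.id c))).comp
          ((Term.id b).par (Term.swap a c)))

section Presented

variable {S : Type s} [Monoid S] {G : S → S → Type h}
  (R : ∀ {a b : S}, Term G a b → Term G a b → Prop)

/-- Diagrams modulo the rewrite rules. -/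
def relSetoid (a b : S) : Setoid (Term G a b) := ⟨Rel R, .refl, .symm, .trans⟩

theorem mk_heq {a b a' b' : S} (ha : a = a') (hb : b = b') {f : Term G a b} {g : Term G a' b'}
    (hfg : Rel R (castHom ha hb f) g) :
    HEq (Quotient.mk (relSetoid R a b) f) (Quotient.mk (relSetoid R a' b') g) := by
  subst ha hb
  exact heq_of_eq (Quotient.sound hfg)

theorem mk_castHom {a b a' b' : S} (ha : a = a') (hb : b = b') (f : Term G a b) :
    Quotient.mk (relSetoid R a' b') (castHom ha hb f) =
      castHom (P := fun a b => Quotient (relSetoid R a b)) ha hb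
        (Quotient.mk (relSetoid R a b) f) := by
  subst ha hb
  rfl

/-- The process theory generated by `G` subject to the rewrite rules `R`. -/
def presented : ProcessTheory.{s, max s h} where
  Sys := S
  Proc a b := Quotient (relSetoid R a b)
  id a := Quotient.mk _ (Term.id a)
  comp := Quotient.map₂ Term.comp fun _ _ hf _ _ hg => Rel.comp hf hg
  par := Quotient.map₂ Term.par fun _ _ hf _ _ hg => Rel.par hf hg
  swap a b := Quotient.mk _ (Term.swap a b)
  id_comp f := by
    induction f using Quotient.inductionOn with | _ f => exact Quotient.sound (Rel.id_comp f)
  comp_id f := by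
    induction f using Quotient.inductionOn with | _ f => exact Quotient.sound (Rel.comp_id f)
  assoc f g k := by
    induction f using Quotient.inductionOn with | _ f =>
    induction g using Quotient.inductionOn with | _ g =>
    induction k using Quotient.inductionOn with | _ k =>
    exact Quotient.sound (Rel.assoc f g k)
  par_id a b := Quotient.sound (Rel.par_id a b)
  par_comp f g f' g' := by
    induction f using Quotient.inductionOn with | _ f =>
    induction g using Quotient.inductionOn with | _ g =>
    induction f' using Quotient.inductionOn with | _ f' =>
    induction g' using Quotient.inductionOn with | _ g' =>
    exact Quotient.sound (Rel.par_comp f g f' g')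
  par_assoc f g l := by
    induction f using Quotient.inductionOn with | _ f =>
    induction g using Quotient.inductionOn with | _ g =>
    induction l using Quotient.inductionOn with | _ l =>
    exact mk_heq R _ _ (Rel.par_assoc f g l)
  one_par f := by
    induction f using Quotient.inductionOn with | _ f => exact mk_heq R _ _ (Rel.one_par f)
  par_one f := by
    induction f using Quotient.inductionOn with | _ f => exact mk_heq R _ _ (Rel.par_one f)
  swap_nat f g := by
    induction f using Quotient.inductionOn with | _ f =>
    induction g using Quotient.inductionOn with | _ g =>
    exact Quotient.sound (Rel.swap_nat f g)
  swap_swap a b := Quotient.sound (Rel.swap_swap a b)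
  hexagon a b c := by
    refine (mk_heq R rfl (mul_assoc b c a) (Rel.hexagon a b c)).trans (heq_of_eq ?_)
    refine Eq.trans ?_ (congrArg (fun z => Quotient.map₂ Term.comp
      (fun _ _ hf _ _ hg => Rel.comp hf hg) z (Quotient.mk (relSetoid R _ _)
        ((Term.id b).par (Term.swap a c)))) (mk_castHom R _ _ _))
    rfl

/-- The class of a formal diagram. -/
def presented.mk {a b : S} (f : Term G a b) : (presented R).Proc a b :=
  Quotient.mk (relSetoid R a b) f

end Presented

/-! ## Laboratory procedures -/

/-- The data that single out an operational theory of laboratory procedures: elementary systems,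
some of which are classical and carry a set of states, and elementary procedures. -/
structure Laboratory where
  /-- elementary systems -/
  Atom : Type u
  /-- which of them are classical -/
  Classical : Set Atom
  /-- the set of states of a classical system -/
  States : Classical → Type u
  /-- elementary procedures between (composite) systems -/
  Procedure : FreeMonoid Atom → FreeMonoid Atom → Type u

/-- The free process theory of laboratory procedures: the only equalities are those between
diagrams with the same connectivity. -/
def Laboratory.Caus (L : Laboratory.{u}) : ProcessTheory.{u, u} :=
  presented (G := L.Procedure) fun {_ _} _ _ => False

/-! ## Composite sets -/

/-- The Cartesian product of a list of sets. -/
def listProd : List (Type u) → Type u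
  | [] => PUnit
  | A :: X => A × listProd X

/-- The set underlying a composite `X` of sets. Composites are formal products, so that parallel
composition of systems is strictly associative. -/
def El (X : FreeMonoid (Type u)) : Type u := listProd X.toList

namespace El

/-- The first part of an element of a product of two lists of sets. -/
def listFst : ∀ (X Y : List (Type u)), listProd (X ++ Y) → listProd X
  | [], _, _ => PUnit.unit
  | _ :: X, Y, p => (p.1, listFst X Y p.2)

/-- The second part of an element of a product of two lists of sets. -/
def listSnd : ∀ (X Y : List (Type u)), listProd (X ++ Y) → listProd Y
  | [], _, p => p
  | _ :: X, Y, p => listSnd X Y p.2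

/-- Juxtaposition. -/
def listJoin : ∀ (X Y : List (Type u)), listProd X → listProd Y → listProd (X ++ Y)
  | [], _, _, q => q
  | _ :: X, Y, p, q => (p.1, listJoin X Y p.2 q)

theorem listJoin_fst_snd : ∀ (X Y : List (Type u)) (p : listProd (X ++ Y)),
    listJoin X Y (listFst X Y p) (listSnd X Y p) = p
  | [], _, _ => rfl
  | _ :: X, Y, p => Prod.ext rfl (listJoin_fst_snd X Y p.2)

theorem listFst_join : ∀ (X Y : List (Type u)) (p : listProd X) (q : listProd Y),
    listFst X Y (listJoin X Y p q) = p
  | [], _, _, _ => rfl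
  | _ :: X, Y, p, q => Prod.ext rfl (listFst_join X Y p.2 q)

theorem listSnd_join : ∀ (X Y : List (Type u)) (p : listProd X) (q : listProd Y),
    listSnd X Y (listJoin X Y p q) = q
  | [], _, _, _ => rfl
  | _ :: X, Y, p, q => listSnd_join X Y p.2 q

/-- The set underlying `X * Y` is the Cartesian product of the underlying sets. -/
def split (X Y : FreeMonoid (Type u)) : El (X * Y) ≃ El X × El Y where
  toFun p := (listFst _ _ p, listSnd _ _ p)
  invFun p := listJoin _ _ p.1 p.2
  left_inv p := listJoin_fst_snd _ _ p
  right_inv p := Prod.ext (listFst_join _ _ p.1 p.2) (listSnd_join _ _ p.1 p.2)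

/-- Juxtaposition of elements. -/
def join {X Y : FreeMonoid (Type u)} (x : El X) (y : El Y) : El (X * Y) := (split X Y).symm (x, y)

/-- First part of an element of a composite. -/
def fst {X Y : FreeMonoid (Type u)} (p : El (X * Y)) : El X := (split X Y p).1

/-- Second part of an element of a composite. -/
def snd {X Y : FreeMonoid (Type u)} (p : El (X * Y)) : El Y := (split X Y p).2

@[simp] theorem fst_join {X Y : FreeMonoid (Type u)} (x : El X) (y : El Y) :
    fst (join x y) = x := by simp [fst, join]

@[simp] theorem snd_join {X Y : FreeMonoid (Type u)} (x : El X) (y : El Y) :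
    snd (join x y) = y := by simp [snd, join]

@[simp] theorem join_fst_snd {X Y : FreeMonoid (Type u)} (p : El (X * Y)) :
    join (fst p) (snd p) = p := by simp [join, fst, snd]

theorem exists_join {X Y : FreeMonoid (Type u)} (p : El (X * Y)) : ∃ x y, p = join x y :=
  ⟨_, _, (join_fst_snd p).symm⟩

/-- The element of the trivial system. -/
def star : El (1 : FreeMonoid (Type u)) := PUnit.unit

/-- A set, as a composite with one component. -/
def single {A : Type u} (a : A) : El (FreeMonoid.of A) := (a, PUnit.unit)

/-- The value of an element of a composite with one component. -/
def value {A : Type u} (p : El (FreeMonoid.of A)) : A := p.1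

/-- Transport along an equality of composites. -/
def cast {X Y : FreeMonoid (Type u)} (e : X = Y) (x : El X) : El Y := e ▸ x

theorem cast_cons {A : Type u} {X Y : List (Type u)} (e : FreeMonoid.ofList X = FreeMonoid.ofList Y)
    (e' : FreeMonoid.ofList (A :: X) = FreeMonoid.ofList (A :: Y)) (a : A) (x : listProd X) :
    cast e' ((a, x) : listProd (A :: X)) =
      ((a, cast (X := FreeMonoid.ofList X) e x) : listProd (A :: Y)) := by
  have e'' : X = Y := e
  subst e''
  rfl

theorem cast_join_join {X Y Z : FreeMonoid (Type u)} (e : X * Y * Z = X * (Y * Z))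
    (x : El X) (y : El Y) (z : El Z) :
    cast e (join (join x y) z) = join x (join y z) := by
  change List (Type u) at X
  induction X with
  | nil => rfl
  | cons A X ih =>
    exact (cast_cons (A := A) (mul_assoc (FreeMonoid.ofList X) Y Z) e x.1 _).trans
      (congrArg (Prod.mk x.1) (ih (mul_assoc (FreeMonoid.ofList X) Y Z) x.2))

theorem cast_join_star {X : FreeMonoid (Type u)} (e : X * 1 = X) (x : El X) :
    cast e (join x star) = x := by
  change List (Type u) at X
  induction X with
  | nil => rfl
  | cons A X ih =>
    exact (cast_cons (A := A) (mul_one (FreeMonoid.ofList X)) e x.1 _).trans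
      (congrArg (Prod.mk x.1) (ih (mul_one (FreeMonoid.ofList X)) x.2))

instance : Subsingleton (El (1 : FreeMonoid (Type u))) := inferInstanceAs (Subsingleton PUnit)

end El

/-! ## Substochastic maps -/

/-- Finitely supported subprobability distributions on a set. -/
def SubDist (A : Type u) : Type u := {d : A →₀ ℝ≥0 // (d.sum fun _ r => r) ≤ 1}

namespace SubDist

variable {A B C : Type u}

/-- Total weight. -/
def mass (d : SubDist A) : ℝ≥0 := d.1.sum fun _ r => r

/-- The point distribution. -/
def pure (a : A) : SubDist A := ⟨Finsupp.single a 1, by simp⟩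

theorem mass_sum (d : A →₀ ℝ≥0) (k : A → B →₀ ℝ≥0) :
    ((d.sum fun a r => r • k a).sum fun _ r => r) = d.sum fun a r => r * (k a).sum fun _ r => r := by
  rw [Finsupp.sum_sum_index (by simp) (by simp)]
  refine Finsupp.sum_congr fun a _ => ?_
  rw [Finsupp.sum_smul_index (by simp), Finsupp.mul_sum]

/-- Averaging a family of subdistributions over a subdistribution. -/
def bind (d : SubDist A) (k : A → SubDist B) : SubDist B :=
  ⟨d.1.sum fun a r => r • (k a).1, by
    rw [mass_sum]
    refine le_trans (Finset.sum_le_sum fun a _ => ?_) d.2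
    exact mul_le_of_le_one_right zero_le (k a).2⟩

theorem pure_bind (a : A) (k : A → SubDist B) : (pure a).bind k = k a := by
  apply Subtype.ext
  simp [pure, bind]

theorem bind_pure (d : SubDist A) : d.bind pure = d := by
  apply Subtype.ext
  simp [pure, bind]

theorem bind_bind (d : SubDist A) (k : A → SubDist B) (l : B → SubDist C) :
    (d.bind k).bind l = d.bind fun a => (k a).bind l := by
  apply Subtype.ext
  simp only [bind]
  rw [Finsupp.sum_sum_index (by simp) (by simp [add_smul])]
  refine Finsupp.sum_congr fun a _ => ?_
  rw [Finsupp.sum_smul_index (by simp), Finsupp.smul_sum]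
  simp [mul_smul]

theorem bind_comm (d : SubDist A) (e : SubDist B) (k : A → B → SubDist C) :
    (d.bind fun a => e.bind fun b => k a b) = e.bind fun b => d.bind fun a => k a b := by
  apply Subtype.ext
  simp only [bind, Finsupp.smul_sum]
  rw [Finsupp.sum_comm]
  refine Finsupp.sum_congr fun a _ => Finsupp.sum_congr fun b _ => ?_
  rw [smul_smul, smul_smul, mul_comm]

end SubDist

/-- Substochastic maps between (composite) sets: kernels of finitely supported
subdistributions. -/
abbrev Kernel (X Y : FreeMonoid (Type u)) : Type u := El X → SubDist (El Y)

namespace Kernel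

/-- Sequential composition. -/
def comp {X Y Z : FreeMonoid (Type u)} (f : Kernel X Y) (g : Kernel Y Z) : Kernel X Z :=
  fun x => (f x).bind g

/-- Parallel composition: the product kernel. -/
def par {X Y Z W : FreeMonoid (Type u)} (f : Kernel X Y) (g : Kernel Z W) :
    Kernel (X * Z) (Y * W) :=
  fun p => (f (El.fst p)).bind fun y => (g (El.snd p)).bind fun w => SubDist.pure (El.join y w)

/-- A function, as a substochastic map. -/
def det {X Y : FreeMonoid (Type u)} (φ : El X → El Y) : Kernel X Y := fun x => SubDist.pure (φ x)

theorem heq_of {X Y X' Y' : FreeMonoid (Type u)} (e : X = X') (e' : Y = Y')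
    (f : Kernel X Y) (g : Kernel X' Y')
    (hfg : ∀ x, g (El.cast e x) = (f x).bind fun y => SubDist.pure (El.cast e' y)) :
    HEq f g := by
  subst e e'
  refine heq_of_eq (funext fun x => ?_)
  exact ((hfg x).trans (SubDist.bind_pure _)).symm

theorem castHom_det {X Y X' Y' : FreeMonoid (Type u)} (e : X = X') (e' : Y = Y')
    (f : Kernel X Y) (x : El X) :
    castHom (P := Kernel) e e' f (El.cast e x) =
      (f x).bind fun y => SubDist.pure (El.cast e' y) := by
  subst e e'
  exact (SubDist.bind_pure _).symm

end Kernel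

/-- The process theory of substochastic maps. -/
def SubStoch : ProcessTheory.{u + 1, u} where
  Sys := FreeMonoid (Type u)
  Proc := Kernel
  id _ := Kernel.det fun x => x
  comp := Kernel.comp
  par := Kernel.par
  swap _ _ := Kernel.det fun p => El.join (El.snd p) (El.fst p)
  id_comp f := funext fun x => SubDist.pure_bind _ _
  comp_id f := funext fun x => SubDist.bind_pure _
  assoc f g k := funext fun x => SubDist.bind_bind _ _ _
  par_id a b := funext fun x => by simp [Kernel.par, Kernel.det, SubDist.pure_bind]
  par_comp f g f' g' := funext fun x => by
    simp only [Kernel.par, Kernel.comp, SubDist.pure_bind, SubDist.bind_bind, El.fst_join,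
      El.snd_join]
    congr 1
    funext y
    rw [SubDist.bind_comm]
  par_assoc f g l := by
    refine Kernel.heq_of (mul_assoc _ _ _) (mul_assoc _ _ _) _ _ fun x => ?_
    obtain ⟨p, z, rfl⟩ := El.exists_join x
    obtain ⟨x, y, rfl⟩ := El.exists_join p
    rw [El.cast_join_join]
    simp [Kernel.par, SubDist.pure_bind, SubDist.bind_bind, El.cast_join_join]
  one_par f := by
    refine Kernel.heq_of (one_mul _) (one_mul _) _ _ fun x => ?_
    change _ = ((SubDist.pure (El.fst x)).bind fun y => (f x).bind fun w =>
      SubDist.pure (El.join y w)).bind fun y => SubDist.pure (El.cast _ y)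
    rw [SubDist.pure_bind, SubDist.bind_bind]
    simp only [SubDist.pure_bind]
    exact (SubDist.bind_pure (f x)).symm
  par_one f := by
    refine Kernel.heq_of (mul_one _) (mul_one _) _ _ fun x => ?_
    obtain ⟨z, p, rfl⟩ := El.exists_join x
    obtain rfl : p = El.star := Subsingleton.elim _ _
    rw [El.cast_join_star]
    simp [Kernel.par, Kernel.det, SubDist.pure_bind, SubDist.bind_bind, El.cast_join_star,
      SubDist.bind_pure]
  swap_nat f g := funext fun x => by
    simp only [Kernel.par, Kernel.comp, Kernel.det, SubDist.pure_bind, SubDist.bind_bind,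
      El.fst_join, El.snd_join]
    rw [SubDist.bind_comm]
  swap_swap a b := funext fun x => by simp [Kernel.comp, Kernel.det, SubDist.pure_bind]
  hexagon a b c := by
    refine Kernel.heq_of rfl (mul_assoc _ _ _) _ _ fun x => ?_
    obtain ⟨x, p, rfl⟩ := El.exists_join x
    obtain ⟨y, z, rfl⟩ := El.exists_join p
    have hc : El.cast rfl (El.join x (El.join y z)) =
        El.cast (mul_assoc a b c) (El.join (El.join x y) z) := by
      rw [El.cast_join_join]; rfl
    rw [hc]
    unfold Kernel.comp
    rw [Kernel.castHom_det]
    simp [Kernel.par, Kernel.det, SubDist.pure_bind, El.cast_join_join]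

/-- A substochastic map all of whose columns are normalized. -/
def IsStochastic {X Y : FreeMonoid (Type u)} (f : Kernel X Y) : Prop := ∀ x, (f x).mass = 1

/-- Marginalization. -/
def marginal (X : FreeMonoid (Type u)) : Kernel X 1 := Kernel.det fun _ => El.star

/-- The point distribution on `a`, as a state of knowledge about the set `A`. -/
def point {A : Type u} (a : A) : Kernel 1 (FreeMonoid.of A) := Kernel.det fun _ => El.single a

/-! ## Classical functional dynamics -/

/-- Functions between (composite) sets. -/
abbrev Fun (X Y : FreeMonoid (Type u)) : Type u := El X → El Y

theorem Fun.heq_of {X Y X' Y' : FreeMonoid (Type u)} (e : X = X') (e' : Y = Y')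
    (f : Fun X Y) (g : Fun X' Y') (hfg : ∀ x, g (El.cast e x) = El.cast e' (f x)) :
    HEq f g := by
  subst e e'
  exact heq_of_eq (funext fun x => (hfg x).symm)

theorem Fun.castHom_apply {X Y X' Y' : FreeMonoid (Type u)} (e : X = X') (e' : Y = Y')
    (f : Fun X Y) (x : El X) :
    castHom (P := Fun) e e' f (El.cast e x) = El.cast e' (f x) := by
  subst e e'
  rfl

/-- The process theory of functions between sets. -/
def SetFun : ProcessTheory.{u + 1, u} where
  Sys := FreeMonoid (Type u)
  Proc := Fun
  id _ := fun x => x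
  comp f g := fun x => g (f x)
  par f g := fun p => El.join (f (El.fst p)) (g (El.snd p))
  swap a b := fun p => El.join (El.snd p) (El.fst p)
  id_comp _ := rfl
  comp_id _ := rfl
  assoc _ _ _ := rfl
  par_id a b := funext fun x => El.join_fst_snd x
  par_comp f g f' g' := by funext x; simp
  par_assoc f g l := by
    refine Fun.heq_of (mul_assoc _ _ _) (mul_assoc _ _ _) _ _ fun x => ?_
    obtain ⟨p, z, rfl⟩ := El.exists_join x
    obtain ⟨x, y, rfl⟩ := El.exists_join p
    rw [El.cast_join_join]
    simp [El.cast_join_join]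
  one_par f := Fun.heq_of (one_mul _) (one_mul _) _ _ fun x => rfl
  par_one f := by
    refine Fun.heq_of (mul_one _) (mul_one _) _ _ fun x => ?_
    obtain ⟨z, p, rfl⟩ := El.exists_join x
    obtain rfl : p = El.star := Subsingleton.elim _ _
    rw [El.cast_join_star]
    simp [El.cast_join_star]
  swap_nat f g := by funext x; simp
  swap_swap a b := by funext x; simp
  hexagon a b c := by
    refine Fun.heq_of rfl (mul_assoc _ _ _) _ _ fun x => ?_
    obtain ⟨x, p, rfl⟩ := El.exists_join x
    obtain ⟨y, z, rfl⟩ := El.exists_join p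
    have hc : El.cast rfl (El.join x (El.join y z)) =
        El.cast (mul_assoc a b c) (El.join (El.join x y) z) := by
      rw [El.cast_join_join]; rfl
    rw [hc, Fun.castHom_apply]
    simp [El.cast_join_join]

/-- Composites of finite sets. -/
def finiteSystems : Submonoid (FreeMonoid (Type u)) where
  carrier := {X | ∀ A ∈ X.toList, Finite A}
  one_mem' := by simp
  mul_mem' hX hY A hA := by
    rcases List.mem_append.1 hA with h | h
    exacts [hX A h, hY A h]

/-- The process theory of functions between finite sets of ontic states. -/
def Func : ProcessTheory.{u + 1, u} := SetFun.full finiteSystems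

/-! ## Causal-inferential theories -/

/-- A theory of causal relations, together with the systems about which one can directly gain
knowledge (closed under parallel composition), and the set of values of each of them. -/
structure CausalTheory where
  Caus : ProcessTheory.{s, u}
  Obs : Type s
  [mon : Monoid Obs]
  sys : Obs →* Caus.Sys
  val : Obs →* FreeMonoid (Type u)

attribute [instance] CausalTheory.mon

/-- A system of a causal-inferential theory: its inferential part and its causal part. -/
abbrev CausalTheory.Sys (C : CausalTheory.{s, u}) : Type (max s (u + 1)) :=
  FreeMonoid (Type u) × C.Caus.Sys

/-- The inferential system of procedures (or mechanisms) from `A` to `B`. -/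
def CausalTheory.Mor (C : CausalTheory.{s, u}) (A B : C.Caus.Sys) : FreeMonoid (Type u) :=
  FreeMonoid.of (C.Caus.Proc A B)

/-- Generating processes of a causal-inferential theory. -/
inductive CIGen (C : CausalTheory.{s, u}) : C.Sys → C.Sys → Type (max s (u + 1))
  /-- inferences -/
  | inf {X Y : FreeMonoid (Type u)} (f : Kernel X Y) : CIGen C (X, 1) (Y, 1)
  /-- specifying a state of knowledge about the process from `A` to `B` -/
  | know (A B : C.Caus.Sys) : CIGen C (C.Mor A B, A) (1, B)
  /-- gaining knowledge about an observable system -/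
  | learn (o : C.Obs) : CIGen C (1, C.sys o) (C.val o, C.sys o)
  /-- ignoring a causal system -/
  | ignore (A : C.Caus.Sys) : CIGen C (1, A) (1, 1)

namespace CITerm

variable {C : CausalTheory.{s, u}}

/-- Formal diagrams of a causal-inferential theory. -/
abbrev _root_.CausalInferential.CITerm (C : CausalTheory.{s, u}) : C.Sys → C.Sys → Type _ :=
  Term (CIGen C)

/-- An inference. -/
def inf {X Y : FreeMonoid (Type u)} (f : Kernel X Y) : CITerm C (X, 1) (Y, 1) := .gen (.inf f)

/-- Specifying a state of knowledge. -/
def know (A B : C.Caus.Sys) : CITerm C (C.Mor A B, A) (1, B) := .gen (.know A B)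

/-- Gaining knowledge. -/
def learn (o : C.Obs) : CITerm C (1, C.sys o) (C.val o, C.sys o) := .gen (.learn o)

/-- Ignoring. -/
def ignore (A : C.Caus.Sys) : CITerm C (1, A) (1, 1) := .gen (.ignore A)

/-- The inference `f` next to an untouched causal system `A`. -/
def onInf {X Y : FreeMonoid (Type u)} (f : Kernel X Y) (A : C.Caus.Sys) :
    CITerm C (X, A) (Y, A) :=
  castHom (by exact Prod.ext (mul_one X) (one_mul A)) (by exact Prod.ext (mul_one Y) (one_mul A))
    ((inf f).par (.id (1, A)))

/-- The diagram `f` next to an untouched inferential system `X`. -/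
def beside (X : FreeMonoid (Type u)) {V W : FreeMonoid (Type u)} {A B : C.Caus.Sys}
    (f : CITerm C (V, A) (W, B)) : CITerm C (X * V, A) (X * W, B) :=
  castHom (by exact Prod.ext rfl (one_mul A)) (by exact Prod.ext rfl (one_mul B))
    (Term.par (.id ((X, 1) : C.Sys)) f)

end CITerm

open CITerm in
/-- The rewrite rules common to operational and classical realist causal-inferential theories. -/
inductive CIRule (C : CausalTheory.{s, u}) : ∀ {a b : C.Sys}, CITerm C a b → CITerm C a b → Prop
  -- inferences compose as substochastic maps do
  | inf_id (X : FreeMonoid (Type u)) : CIRule C (inf (SubStoch.id X)) (.id (X, 1))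
  | inf_comp {X Y Z : FreeMonoid (Type u)} (f : Kernel X Y) (g : Kernel Y Z) :
      CIRule C (inf (SubStoch.comp f g)) ((inf f).comp (inf g))
  | inf_par {X Y Z W : FreeMonoid (Type u)} (f : Kernel X Y) (g : Kernel Z W) :
      CIRule C (inf (SubStoch.par f g))
        (castHom (by exact Prod.ext rfl (one_mul 1)) (by exact Prod.ext rfl (one_mul 1)) (Term.par (inf (C := C) f) (inf g)))
  | inf_swap (X Y : FreeMonoid (Type u)) :
      CIRule C (inf (SubStoch.swap X Y))
        (castHom (by exact Prod.ext rfl (one_mul 1)) (by exact Prod.ext rfl (one_mul 1))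
          (.swap ((X, 1) : C.Sys) (Y, 1)))
  -- crossings of inferential wires with causal wires are immaterial
  | mixed_swap (X : FreeMonoid (Type u)) (A : C.Caus.Sys) :
      CIRule C (castHom (by exact Prod.ext (mul_one X) (one_mul A)) (by exact Prod.ext (one_mul X) (mul_one A))
        (.swap ((X, 1) : C.Sys) (1, A))) (.id (X, A))
  -- knowledge about sequential and parallel composites, identities and swaps
  | know_comp (A B D : C.Caus.Sys) :
      CIRule C
        ((castHom rfl (by exact Prod.ext (mul_one _) rfl) (beside (C.Mor B D) (know A B))).comp (know B D))
        ((onInf (Kernel.det fun p => El.single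
          (C.Caus.comp (El.value (El.snd p)) (El.value (El.fst p)))) A).comp (know A D))
  | know_par (A B A' B' : C.Caus.Sys) :
      CIRule C (castHom rfl (by exact Prod.ext (one_mul 1) rfl) ((know A B).par (know A' B')))
        ((onInf (Kernel.det fun p => El.single
          (C.Caus.par (El.value (El.fst p)) (El.value (El.snd p)))) (A * A')).comp
            (know (A * A') (B * B')))
  | know_id (A : C.Caus.Sys) :
      CIRule C ((onInf (point (C.Caus.id A)) A).comp (know A A)) (.id (1, A))
  | know_swap (A B : C.Caus.Sys) :
      CIRule C ((onInf (point (C.Caus.swap A B)) (A * B)).comp (know (A * B) (B * A)))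
        (castHom (by exact Prod.ext (one_mul 1) rfl) (by exact Prod.ext (one_mul 1) rfl)
          (.swap ((1, A) : C.Sys) (1, B)))
  -- gaining knowledge and then disregarding it; gaining it twice; about composites
  | learn_marginal (o : C.Obs) :
      CIRule C ((learn o).comp (onInf (marginal (C.val o)) (C.sys o))) (.id (1, C.sys o))
  | learn_learn (o : C.Obs) :
      CIRule C
        ((learn o).comp (castHom (by exact Prod.ext (mul_one _) rfl) rfl (beside (C.val o) (learn o))))
        ((learn o).comp (onInf (Kernel.det fun x => El.join x x) (C.sys o)))
  | learn_par (o o' : C.Obs) :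
      CIRule C
        (castHom (by exact Prod.ext (one_mul 1).symm (map_mul C.sys o o'))
          (by exact Prod.ext (map_mul C.val o o') (map_mul C.sys o o')) (learn (o * o')))
        ((learn o).par (learn o'))
  -- ignoring the trivial system, and composites
  | ignore_one : CIRule C (ignore 1) (.id (1, 1))
  | ignore_par (A B : C.Caus.Sys) :
      CIRule C
        (castHom (by exact Prod.ext (one_mul 1).symm rfl) (by exact Prod.ext (one_mul 1).symm (one_mul 1).symm)
          (ignore (A * B)))
        ((ignore A).par (ignore B))
  -- ignorability
  | know_ignore (A B : C.Caus.Sys) :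
      CIRule C ((know A B).comp (ignore B)) ((onInf (marginal (C.Mor A B)) A).comp (ignore A))

/-- A causal-inferential theory: a causal theory and possibly further rewrite rules. -/
structure CITheory where
  C : CausalTheory.{s, u}
  Rule : ∀ {a b : C.Sys}, CITerm C a b → CITerm C a b → Prop

namespace CITheory

variable (K : CITheory.{s, u})

/-- All rewrite rules. -/
def AllRules {a b : K.C.Sys} (f g : CITerm K.C a b) : Prop := CIRule K.C f g ∨ K.Rule f g

/-- The process theory of causal-inferential diagrams, modulo all rewrite rules. -/
def theory : ProcessTheory.{max s (u + 1), max s (u + 1)} :=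
  presented (G := CIGen K.C) K.AllRules

/-- The process represented by a formal diagram. -/
def diagram {a b : K.C.Sys} (f : CITerm K.C a b) : K.theory.Proc a b := presented.mk _ f

/-- Systems without causal part. -/
def closed : Submonoid K.theory.Sys :=
  MonoidHom.mker (MonoidHom.snd (FreeMonoid (Type u)) K.C.Caus.Sys)

/-- The sub-process-theory of causally closed processes. -/
def Closed : ProcessTheory.{max s (u + 1), max s (u + 1)} := K.theory.full K.closed

/-- The inclusion of inferences in the theory. -/
def i : DPMap SubStoch.{u} K.theory where
  obj := MonoidHom.inl (FreeMonoid (Type u)) K.C.Caus.Sys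
  map f := K.diagram (CITerm.inf f)
  map_id X := Quotient.sound (Rel.of (Or.inl (CIRule.inf_id X)))
  map_comp f g := Quotient.sound (Rel.of (Or.inl (CIRule.inf_comp f g)))
  map_par f g := (mk_heq K.AllRules (by exact Prod.ext rfl (one_mul 1))
    (by exact Prod.ext rfl (one_mul 1)) (Rel.symm (Rel.of (Or.inl (CIRule.inf_par f g))))).symm
  map_swap X Y := (mk_heq K.AllRules (by exact Prod.ext rfl (one_mul 1))
    (by exact Prod.ext rfl (one_mul 1)) (Rel.symm (Rel.of (Or.inl (CIRule.inf_swap X Y))))).symm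

/-- The inclusion of inferences in the causally closed processes. -/
def iClosed : DPMap SubStoch.{u} K.Closed where
  obj :=
    { toFun X := ⟨(X, 1), rfl⟩
      map_one' := rfl
      map_mul' _ _ := Subtype.ext (Prod.ext rfl (one_mul 1).symm) }
  map {X Y} f := K.i.map (a := X) (b := Y) f
  map_id X := K.i.map_id X
  map_comp f g := K.i.map_comp f g
  map_par f g := K.i.map_par f g
  map_swap X Y := K.i.map_swap X Y

/-- A prediction map: a partial diagram-preserving map, defined on causally closed processes, that
is a left inverse of the inclusion of inferences. -/
structure Prediction where
  p : DPMap K.Closed SubStoch.{u}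
  p_i : p.comp K.iClosed = DPMap.id SubStoch

end CITheory

/-! ## Inferential equivalence and quotiented theories -/

section Quotienting

variable {T : ProcessTheory.{s, h}} {S : Submonoid T.Sys} {U : ProcessTheory.{s', h'}}

/-- Embedding of a process in the tester made of `x`, `y` and an auxiliary system `W`. -/
def test {a b : T.Sys} {c d W : T.Sys} (x : T.Proc c (a * W)) (y : T.Proc (b * W) d)
    (f : T.Proc a b) : T.Proc c d :=
  T.comp (T.comp x (T.par f (T.id W))) y

/-- Inferential equivalence: the same predictions in all testers. -/
def InfEquiv (p : DPMap (T.full S) U) {a b : T.Sys} (f g : T.Proc a b) : Prop :=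
  ∀ (c d : S) (W : T.Sys) (x : T.Proc c (a * W)) (y : T.Proc (b * W) d),
    p.map (a := c) (b := d) (test (T := T) x y f) = p.map (a := c) (b := d) (test (T := T) x y g)

namespace InfEquiv

variable {p : DPMap (T.full S) U}

theorem refl {a b : T.Sys} (f : T.Proc a b) : InfEquiv p f f := fun _ _ _ _ _ => rfl

theorem symm {a b : T.Sys} {f g : T.Proc a b} (hfg : InfEquiv p f g) : InfEquiv p g f :=
  fun c d W x y => (hfg c d W x y).symm

theorem trans {a b : T.Sys} {f g k : T.Proc a b} (hfg : InfEquiv p f g) (hgk : InfEquiv p g k) :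
    InfEquiv p f k := fun c d W x y => (hfg c d W x y).trans (hgk c d W x y)

theorem comp_left {a b c : T.Sys} (f : T.Proc a b) {g g' : T.Proc b c} (hg : InfEquiv p g g') :
    InfEquiv p (T.comp f g) (T.comp f g') := by
  have key : ∀ (c' d' W : T.Sys) (x : T.Proc c' (a * W)) (y : T.Proc (c * W) d')
      (k : T.Proc b c), test x y (T.comp f k) = test (T.comp x (T.par f (T.id W))) y k := by
    intro c' d' W x y k
    have : T.par (T.comp f k) (T.id W) = T.comp (T.par f (T.id W)) (T.par k (T.id W)) := by
      rw [← T.par_comp, T.id_comp]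
    simp only [test, this, T.assoc]
  intro c' d' W x y
  rw [key, key]
  exact hg _ _ _ _ _

theorem comp_right {a b c : T.Sys} {f f' : T.Proc a b} (hf : InfEquiv p f f') (g : T.Proc b c) :
    InfEquiv p (T.comp f g) (T.comp f' g) := by
  have key : ∀ (c' d' W : T.Sys) (x : T.Proc c' (a * W)) (y : T.Proc (c * W) d')
      (k : T.Proc a b), test x y (T.comp k g) = test x (T.comp (T.par g (T.id W)) y) k := by
    intro c' d' W x y k
    have : T.par (T.comp k g) (T.id W) = T.comp (T.par k (T.id W)) (T.par g (T.id W)) := by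
      rw [← T.par_comp, T.id_comp]
    simp only [test, this, T.assoc]
  intro c' d' W x y
  rw [key, key]
  exact hf _ _ _ _ _

theorem comp_congr_heq {a b c a' b' c' : T.Sys} (ha : a = a') (hb : b = b') (hc : c = c')
    {f : T.Proc a b} {g : T.Proc b c} {f' : T.Proc a' b'} {g' : T.Proc b' c'}
    (hf : HEq f f') (hg : HEq g g') : HEq (T.comp f g) (T.comp f' g') := by
  subst ha hb hc
  rw [eq_of_heq hf, eq_of_heq hg]

theorem par_right_id {a b : T.Sys} {f f' : T.Proc a b} (hf : InfEquiv p f f') (e : T.Sys) :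
    InfEquiv p (T.par f (T.id e)) (T.par f' (T.id e)) := by
  have key : ∀ (c' d' W : T.Sys) (x : T.Proc c' (a * e * W)) (y : T.Proc (b * e * W) d')
      (k : T.Proc a b), test x y (T.par k (T.id e)) =
        test (castHom rfl (mul_assoc a e W) x) (castHom (mul_assoc b e W) rfl y) k := by
    intro c' d' W x y k
    refine eq_of_heq (comp_congr_heq rfl (mul_assoc _ _ _) rfl
      (comp_congr_heq rfl (mul_assoc _ _ _) (mul_assoc _ _ _) (castHom_heq _ _ _).symm ?_)
      (castHom_heq _ _ _).symm)
    rw [← T.par_id]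
    exact T.par_assoc _ _ _
  intro c' d' W x y
  rw [key, key]
  exact hf _ _ _ _ _

theorem par_left_id {a b : T.Sys} {f f' : T.Proc a b} (hf : InfEquiv p f f') (e : T.Sys) :
    InfEquiv p (T.par (T.id e) f) (T.par (T.id e) f') := by
  have key : ∀ k : T.Proc a b, T.par (T.id e) k =
      T.comp (T.comp (T.swap e a) (T.par k (T.id e))) (T.swap b e) := by
    intro k
    rw [← T.swap_nat, T.assoc, T.swap_swap, T.comp_id]
  rw [key, key]
  exact comp_right (comp_left _ (par_right_id hf e)) _

theorem comp {a b c : T.Sys} {f f' : T.Proc a b} {g g' : T.Proc b c} (hf : InfEquiv p f f')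
    (hg : InfEquiv p g g') : InfEquiv p (T.comp f g) (T.comp f' g') :=
  (comp_right hf g).trans (comp_left f' hg)

theorem par {a b c d : T.Sys} {f f' : T.Proc a b} {g g' : T.Proc c d} (hf : InfEquiv p f f')
    (hg : InfEquiv p g g') : InfEquiv p (T.par f g) (T.par f' g') := by
  have key : ∀ (f : T.Proc a b) (g : T.Proc c d),
      T.par f g = T.comp (T.par f (T.id c)) (T.par (T.id b) g) := by
    intro f g
    rw [← T.par_comp, T.comp_id, T.id_comp]
  rw [key f g, key f' g']
  exact comp (par_right_id hf c) (par_left_id hg b)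

/-- Equivalent processes in the domain of the prediction map have the same prediction. -/
theorem map_eq {a b : S} {f g : T.Proc a b} (hfg : InfEquiv p f g) :
    p.map (a := a) (b := b) f = p.map (a := a) (b := b) g := by
  have key : ∀ k : T.Proc a b,
      test (castHom rfl (mul_one a.1).symm (T.id a.1)) (castHom (mul_one b.1).symm rfl (T.id b.1)) k
        = k := by
    intro k
    refine eq_of_heq (HEq.trans (comp_congr_heq (f' := T.comp (T.id a.1) k) (g' := T.id b.1) rfl
      (mul_one _) rfl (comp_congr_heq rfl (mul_one _) (mul_one _) (castHom_heq _ _ _)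
        (T.par_one k)) (castHom_heq _ _ _)) ?_)
    rw [T.comp_id, T.id_comp]
  have := hfg a b 1 (castHom rfl (mul_one a.1).symm (T.id a.1))
    (castHom (mul_one b.1).symm rfl (T.id b.1))
  rwa [key, key] at this

end InfEquiv

/-- Inferential equivalence as a setoid. -/
def infSetoid (p : DPMap (T.full S) U) (a b : T.Sys) : Setoid (T.Proc a b) :=
  ⟨InfEquiv p, .refl, .symm, .trans⟩

theorem quot_heq (p : DPMap (T.full S) U) {a b a' b' : T.Sys} (ha : a = a') (hb : b = b')
    {f : T.Proc a b} {g : T.Proc a' b'} (hfg : HEq f g) :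
    HEq (Quotient.mk (infSetoid p a b) f) (Quotient.mk (infSetoid p a' b') g) := by
  subst ha hb
  rw [eq_of_heq hfg]

theorem quot_castHom (p : DPMap (T.full S) U) {a b a' b' : T.Sys} (ha : a = a') (hb : b = b')
    (f : T.Proc a b) : Quotient.mk (infSetoid p a' b') (castHom ha hb f) =
      castHom (P := fun a b => Quotient (infSetoid p a b)) ha hb
        (Quotient.mk (infSetoid p a b) f) := by
  subst ha hb
  rfl

/-- The quotient of a process theory by inferential equivalence. -/
def quotiented (p : DPMap (T.full S) U) : ProcessTheory.{s, h} where
  Sys := T.Sys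
  Proc a b := Quotient (infSetoid p a b)
  id a := Quotient.mk _ (T.id a)
  comp := Quotient.map₂ T.comp fun _ _ hf _ _ hg => InfEquiv.comp hf hg
  par := Quotient.map₂ T.par fun _ _ hf _ _ hg => InfEquiv.par hf hg
  swap a b := Quotient.mk _ (T.swap a b)
  id_comp f := by
    induction f using Quotient.inductionOn with
    | _ f => exact congrArg (Quotient.mk _) (T.id_comp f)
  comp_id f := by
    induction f using Quotient.inductionOn with
    | _ f => exact congrArg (Quotient.mk _) (T.comp_id f)
  assoc f g k := by
    induction f using Quotient.inductionOn with | _ f =>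
    induction g using Quotient.inductionOn with | _ g =>
    induction k using Quotient.inductionOn with | _ k =>
    exact congrArg (Quotient.mk _) (T.assoc f g k)
  par_id a b := congrArg (Quotient.mk _) (T.par_id a b)
  par_comp f g f' g' := by
    induction f using Quotient.inductionOn with | _ f =>
    induction g using Quotient.inductionOn with | _ g =>
    induction f' using Quotient.inductionOn with | _ f' =>
    induction g' using Quotient.inductionOn with | _ g' =>
    exact congrArg (Quotient.mk _) (T.par_comp f g f' g')
  par_assoc f g l := by
    induction f using Quotient.inductionOn with | _ f =>
    induction g using Quotient.inductionOn with | _ g =>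
    induction l using Quotient.inductionOn with | _ l =>
    exact quot_heq p (mul_assoc _ _ _) (mul_assoc _ _ _) (T.par_assoc f g l)
  one_par f := by
    induction f using Quotient.inductionOn with
    | _ f => exact quot_heq p (one_mul _) (one_mul _) (T.one_par f)
  par_one f := by
    induction f using Quotient.inductionOn with
    | _ f => exact quot_heq p (mul_one _) (mul_one _) (T.par_one f)
  swap_nat f g := by
    induction f using Quotient.inductionOn with | _ f =>
    induction g using Quotient.inductionOn with | _ g =>
    exact congrArg (Quotient.mk _) (T.swap_nat f g)
  swap_swap a b := congrArg (Quotient.mk _) (T.swap_swap a b)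
  hexagon a b c := by
    refine (quot_heq p rfl (mul_assoc b c a) (T.hexagon a b c)).trans (heq_of_eq ?_)
    exact congrArg (fun z => Quotient.map₂ T.comp
      (fun _ _ hf _ _ hg => InfEquiv.comp hf hg) z (Quotient.mk (infSetoid p _ _)
        (T.par (T.id b) (T.swap a c)))) (quot_castHom p _ _ _)

/-- The quotient map. -/
def toQuot (p : DPMap (T.full S) U) : DPMap T (quotiented p) where
  obj := MonoidHom.id _
  map f := Quotient.mk _ f
  map_id _ := rfl
  map_comp _ _ := rfl
  map_par _ _ := HEq.rfl
  map_swap _ _ := HEq.rfl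

/-- The prediction map of the quotiented theory. -/
def quotPrediction (p : DPMap (T.full S) U) : DPMap ((quotiented p).full S) U where
  obj := p.obj
  map {a b} f := Quotient.lift (s := infSetoid p a.1 b.1) (fun f => p.map (a := a) (b := b) f)
    (fun _ _ hfg => InfEquiv.map_eq hfg) f
  map_id a := p.map_id a
  map_comp f g := by
    induction f using Quotient.inductionOn with | _ f =>
    induction g using Quotient.inductionOn with | _ g =>
    exact p.map_comp f g
  map_par f g := by
    induction f using Quotient.inductionOn with | _ f =>
    induction g using Quotient.inductionOn with | _ g =>
    exact p.map_par f g
  map_swap a b := p.map_swap a b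

end Quotienting

namespace CITheory.Prediction

variable {K : CITheory.{s, u}} (P : K.Prediction)

/-- The quotiented causal-inferential theory. -/
def QuotTheory : ProcessTheory.{max s (u + 1), max s (u + 1)} := quotiented P.p

/-- The class of a formal diagram in the quotiented theory. -/
def cls {a b : K.C.Sys} (f : CITerm K.C a b) : P.QuotTheory.Proc a b := (toQuot P.p).map (K.diagram f)

/-- Systems of the quotiented theory without causal part. -/
def closedQ : Submonoid P.QuotTheory.Sys := K.closed

/-- The prediction map of the quotiented theory. -/
def pQ : DPMap (P.QuotTheory.full P.closedQ) SubStoch.{u} := quotPrediction P.p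

end CITheory.Prediction

/-! ## Operational and classical realist theories -/

/-- The operational causal-inferential theory of a laboratory: knowledge can be gained about
(composites of) classical systems only. -/
def operational (L : Laboratory.{u}) : CITheory.{u, u} where
  C :=
    { Caus := L.Caus
      Obs := FreeMonoid L.Classical
      sys := FreeMonoid.map fun X : L.Classical => (X : L.Atom)
      val := FreeMonoid.map L.States }
  Rule _ _ := False

/-- The causal theory of functional dynamics: knowledge can be gained about every system. -/
def functional : CausalTheory.{u + 1, u} where
  Caus := Func
  Obs := finiteSystems
  sys := MonoidHom.id _
  val := finiteSystems.subtype

open CITerm in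
/-- The rewrite rule specific to functional dynamics: what one learns about the output is what
is obtained by applying the function to what one learns about the input. -/
inductive PropagationRule : ∀ {a b : functional.{u}.Sys},
    CITerm functional.{u} a b → CITerm functional.{u} a b → Prop
  | propagate (Λ M : finiteSystems.{u}) :
      PropagationRule ((know (C := functional) Λ M).comp (learn (C := functional) M))
        (((castHom (by exact Prod.ext (mul_one _) rfl) rfl
              (beside (functional.Mor Λ M) (learn (C := functional) Λ))).comp
            (onInf (C := functional) (X := functional.Mor Λ M * Λ.1)
              (Y := M.1 * functional.Mor Λ M)
              (Kernel.det fun q => El.join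
                ((El.value (El.fst q) : El Λ.1 → El M.1) (El.snd q)) (El.fst q)) Λ)).comp
          (castHom (a := (M.1 * functional.Mor Λ M, Λ)) (b := (M.1 * 1, M)) rfl
            (by exact Prod.ext (mul_one _) rfl) (beside M.1 (know (C := functional) Λ M))))

/-- The classical realist causal-inferential theory. -/
def classicalRealist : CITheory.{u + 1, u} where
  C := functional
  Rule f g := PropagationRule f g

/-- A classical realist representation of a quotiented operational theory: a diagram-preserving
map to the quotiented classical realist theory that represents causal systems by causal systems,
and that preserves predictions and ignorability. -/
structure Representation {L : Laboratory.{u}} (P : (operational L).Prediction)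
    (P' : classicalRealist.{u}.Prediction) extends DPMap P.QuotTheory P'.QuotTheory where
  /-- the ontic state space representing a causal system -/
  space : L.Caus.Sys → Func.{u}.Sys
  obj_causal : ∀ A : L.Caus.Sys, obj ((1, A) : (operational L).C.Sys) = (1, space A)
  closed_of_closed : ∀ a ∈ P.closedQ, obj a ∈ P'.closedQ
  predictions : P'.pQ.comp (toDPMap.restrict P.closedQ P'.closedQ closed_of_closed) = P.pQ
  ignorability : ∀ A : L.Caus.Sys, HEq (map (P.cls (CITerm.ignore A)))
    (P'.cls (CITerm.ignore (C := functional) (space A)))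

end CausalInferential

namespace CausalInferential

/-! The proof tests the image of `κ` on prepared ontic states. In the functional theory, a causal
system `Λ` can be prepared by applying `κ` to knowledge about a function `1 → Λ`, that is, about an
ontic state. Every diagram preceded by the preparation of its input equals an inference followed by
the preparation of its output (`actsByInf`). This goes by induction on diagrams. The propagation
rule handles gaining knowledge, ignorability handles ignoring, and parallel composition works
because a state of a composite is the same as a pair of states (`factors_prepCaus_mul`).

Two consequences follow. A process without causal ends is an inference (`exists_kern`). Moreover,
whatever precedes a process in a tester amounts to an inference followed by preparations, so
processes that agree after preparation of their input are inferentially equivalent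
(`infEquiv_of_prep_comp_eq`).

A representation fixes every inference, since it preserves predictions and prediction maps fix
inferences (`arr_kern`). Hence a representative of the image of `κ` acts on prepared states by a
kernel `k` from pairs (procedure, ontic state of `Λ_A`) to ontic states of `Λ_B`. Preservation of
ignorability becomes an equality of inferences in the quotient, where no two distinct kernels are
identified (`Prediction.kernel_eq`), and it forces `k` to be stochastic (`exists_isStochastic`).

Finally, for each procedure, `k` gives finitely many normalized distributions, one per ontic state
of `Λ_A`. Drawing the values independently gives a distribution on functions with these marginals
(`exists_joint`), and this is the column of `Ξ`. Then `κ` fed by `Ξ` also acts on prepared states by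
`k`, so it is equivalent to the image of `κ`.

Throughout, processes are bundled with their ends: parallel composition is then an honest monoid
multiplication, and casts along equalities of systems vanish. -/

/-! ## The monoid of all processes of a process theory -/

/-- A process bundled with its input and output systems. -/
structure Arr (T : ProcessTheory.{s, h}) where
  src : T.Sys
  tgt : T.Sys
  hom : T.Proc src tgt

namespace Arr

variable {T : ProcessTheory.{s, h}} {U : ProcessTheory.{s', h'}}

/-- Heterogeneous laws of a process theory become plain equalities here; `heq_of_mk_eq` and `mk_inj`
go back. -/
theorem mk_eq {a b a' b' : T.Sys} (ha : a = a') (hb : b = b') {f : T.Proc a b}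
    {g : T.Proc a' b'} (hfg : HEq f g) : (⟨a, b, f⟩ : Arr T) = ⟨a', b', g⟩ := by
  subst ha hb
  rw [eq_of_heq hfg]

theorem heq_of_mk_eq {a b a' b' : T.Sys} {f : T.Proc a b} {g : T.Proc a' b'}
    (e : (⟨a, b, f⟩ : Arr T) = ⟨a', b', g⟩) : HEq f g := by
  injection e

theorem mk_inj {a b : T.Sys} {f g : T.Proc a b} (e : (⟨a, b, f⟩ : Arr T) = ⟨a, b, g⟩) : f = g :=
  eq_of_heq (heq_of_mk_eq e)

/-- Processes form a monoid under parallel composition. -/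
instance : Monoid (Arr T) where
  mul f g := ⟨_, _, T.par f.hom g.hom⟩
  one := ⟨1, 1, T.id 1⟩
  mul_assoc f g k := mk_eq (mul_assoc _ _ _) (mul_assoc _ _ _) (T.par_assoc _ _ _)
  one_mul f := mk_eq (one_mul _) (one_mul _) (T.one_par _)
  mul_one f := mk_eq (mul_one _) (mul_one _) (T.par_one _)

@[simp] theorem src_mul (f g : Arr T) : (f * g).src = f.src * g.src := rfl
@[simp] theorem tgt_mul (f g : Arr T) : (f * g).tgt = f.tgt * g.tgt := rfl

/-- The identity process. -/
def idn (a : T.Sys) : Arr T := ⟨a, a, T.id a⟩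

theorem idn_mul (a b : T.Sys) : idn (a * b) = idn a * idn b :=
  mk_eq rfl rfl (heq_of_eq (T.par_id a b).symm)

/-- Sequential composition of processes with matching ends. -/
def comp (f g : Arr T) (e : f.tgt = g.src) : Arr T :=
  ⟨f.src, g.tgt, T.comp f.hom (castHom e.symm rfl g.hom)⟩

theorem comp_assoc (f g k : Arr T) (e : f.tgt = g.src) (e' : (f.comp g e).tgt = k.src) :
    (f.comp g e).comp k e' = f.comp (g.comp k e') e := by
  obtain ⟨a, b, f⟩ := f
  obtain ⟨b', c, g⟩ := g
  obtain ⟨c', d, k⟩ := k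
  obtain rfl : b = b' := e
  obtain rfl : c = c' := e'
  exact mk_eq rfl rfl (heq_of_eq (T.assoc f g k))

theorem idn_comp (a : T.Sys) (f : Arr T) (e : (idn a).tgt = f.src) : (idn a).comp f e = f := by
  obtain ⟨b, c, f⟩ := f
  obtain rfl : a = b := e
  exact mk_eq rfl rfl (heq_of_eq (T.id_comp f))

theorem comp_idn (a : T.Sys) (f : Arr T) (e : f.tgt = (idn a).src) : f.comp (idn a) e = f := by
  obtain ⟨b, c, f⟩ := f
  obtain rfl : c = a := e
  exact mk_eq rfl rfl (heq_of_eq (T.comp_id f))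

theorem comp_eq_left {f g : Arr T} {a : T.Sys} (hg : g = idn a) (e : f.tgt = g.src) :
    f.comp g e = f := by
  subst hg
  exact comp_idn a f e

theorem comp_eq_right {f g : Arr T} {a : T.Sys} (hf : f = idn a) (e : f.tgt = g.src) :
    f.comp g e = g := by
  subst hf
  exact idn_comp a g e

theorem comp_mul_comp (f g f' g' : Arr T) (e : f.tgt = g.src) (e' : f'.tgt = g'.src) :
    f.comp g e * f'.comp g' e' = (f * f').comp (g * g') (congrArg₂ (· * ·) e e') := by
  obtain ⟨a, b, f⟩ := f
  obtain ⟨b', c, g⟩ := g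
  obtain ⟨a', d, f'⟩ := f'
  obtain ⟨d', c', g'⟩ := g'
  obtain rfl : b = b' := e
  obtain rfl : d = d' := e'
  exact mk_eq rfl rfl (heq_of_eq (T.par_comp f g f' g'))

theorem comp_congr {f f' g g' : Arr T} (hf : f = f') (hg : g = g') (e : f.tgt = g.src) :
    f.comp g e = f'.comp g' (hf ▸ hg ▸ e) := by
  subst hf hg
  rfl

/-- The swap. -/
def swap (a b : T.Sys) : Arr T := ⟨a * b, b * a, T.swap a b⟩

/-- The ends are separate variables tied by equations, so that the swaps can be stated at systems
such as `(1, A)` when the ends of `f` equal them only propositionally. -/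
theorem mul_comp_swap (f g : Arr T) {a b c d : T.Sys} (hb : f.tgt = b) (hd : g.tgt = d)
    (ha : f.src = a) (hc : g.src = c) :
    (f * g).comp (swap b d) (by rw [tgt_mul, hb, hd]; rfl) =
      (swap a c).comp (g * f) (by rw [src_mul, ha, hc]; rfl) := by
  subst ha hb hc hd
  exact mk_eq rfl rfl (heq_of_eq (T.swap_nat f.hom g.hom))

theorem swap_comp_swap (a b : T.Sys) : (swap a b).comp (swap b a) rfl = idn (a * b) :=
  mk_eq rfl rfl (heq_of_eq (T.swap_swap a b))

end Arr

/-- The action of a diagram-preserving map on bundled processes. -/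
def DPMap.arr {T : ProcessTheory.{s, h}} {U : ProcessTheory.{s', h'}} (F : DPMap T U) :
    Arr T →* Arr U where
  toFun f := ⟨_, _, F.map f.hom⟩
  map_one' := Arr.mk_eq (map_one F.obj) (map_one F.obj)
    ((heq_of_eq (F.map_id 1)).trans (Arr.heq_of_mk_eq (congrArg Arr.idn (map_one F.obj))))
  map_mul' _ _ := Arr.mk_eq (map_mul F.obj _ _) (map_mul F.obj _ _) (F.map_par _ _)

namespace DPMap

variable {T : ProcessTheory.{s, h}} {U : ProcessTheory.{s', h'}} (F : DPMap T U)

theorem arr_idn (a : T.Sys) : F.arr (Arr.idn a) = Arr.idn (F.obj a) :=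
  Arr.mk_eq rfl rfl (heq_of_eq (F.map_id a))

theorem arr_comp (f g : Arr T) (e : f.tgt = g.src) :
    F.arr (f.comp g e) = (F.arr f).comp (F.arr g) (congrArg F.obj e) := by
  obtain ⟨a, b, f⟩ := f
  obtain ⟨b', c, g⟩ := g
  obtain rfl : b = b' := e
  exact Arr.mk_eq rfl rfl (heq_of_eq (F.map_comp f g))

theorem map_heq_of_eq {F G : DPMap T U} (e : F = G) {a b : T.Sys} (f : T.Proc a b) :
    HEq (F.map f) (G.map f) := by
  rw [e]

end DPMap

/-! ## Bundled processes of a causal-inferential theory -/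

namespace CITheory

variable {K : CITheory.{s, u}}

/-- The bundled process represented by a formal diagram. -/
def tm {a b : K.C.Sys} (f : CITerm K.C a b) : Arr K.theory := ⟨a, b, K.diagram f⟩

/-- The bundled process given by an inference. -/
def kern (K : CITheory.{s, u}) {X Y : FreeMonoid (Type u)} (k : Kernel X Y) : Arr K.theory :=
  tm (CITerm.inf k)

/-- The identity process of an inferential system. -/
def idInf (K : CITheory.{s, u}) (X : FreeMonoid (Type u)) : Arr K.theory :=
  Arr.idn (T := K.theory) (X, 1)

/-- The identity process of a causal system. -/
def idCaus (K : CITheory.{s, u}) (A : K.C.Caus.Sys) : Arr K.theory :=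
  Arr.idn (T := K.theory) (1, A)

-- Through this the rewrite rules, which are stated with casts, become cast-free equations between
-- products and composites.
@[simp] theorem tm_castHom {a b a' b' : K.C.Sys} (ha : a = a') (hb : b = b')
    (f : CITerm K.C a b) : tm (castHom ha hb f) = tm f := by
  subst ha hb
  rfl

theorem tm_par {a b c d : K.C.Sys} (f : CITerm K.C a b) (g : CITerm K.C c d) :
    tm (f.par g) = tm f * tm g := rfl

theorem tm_id (a : K.C.Sys) : tm (.id a : CITerm K.C a a) = Arr.idn (T := K.theory) a := rfl

theorem tm_swap (a b : K.C.Sys) :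
    tm (.swap a b : CITerm K.C (a * b) (b * a)) = Arr.swap (T := K.theory) a b := rfl

theorem tm_onInf {X Y : FreeMonoid (Type u)} (f : Kernel X Y) (A : K.C.Caus.Sys) :
    tm (CITerm.onInf f A) = kern K f * idCaus K A := by
  rw [CITerm.onInf, tm_castHom, tm_par, tm_id]
  rfl

theorem tm_beside (X : FreeMonoid (Type u)) {V W : FreeMonoid (Type u)} {A B : K.C.Caus.Sys}
    (f : CITerm K.C (V, A) (W, B)) : tm (CITerm.beside X f) = idInf K X * tm f := by
  rw [CITerm.beside, tm_castHom, tm_par, tm_id]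
  rfl

theorem tm_eq {a b : K.C.Sys} {f g : CITerm K.C a b} (hfg : CIRule K.C f g) : tm f = tm g :=
  Arr.mk_eq rfl rfl (heq_of_eq (Quotient.sound (Rel.of (Or.inl hfg))))

theorem tm_eq_of_rule {a b : K.C.Sys} {f g : CITerm K.C a b} (hfg : K.Rule f g) : tm f = tm g :=
  Arr.mk_eq rfl rfl (heq_of_eq (Quotient.sound (Rel.of (Or.inr hfg))))

theorem comp_eq_comp {a b b' c : K.C.Sys} {f : CITerm K.C a b} {g : CITerm K.C b c}
    {f' : CITerm K.C a b'} {g' : CITerm K.C b' c} (h : K.AllRules (f.comp g) (f'.comp g')) :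
    (tm f).comp (tm g) rfl = (tm f').comp (tm g') rfl :=
  h.elim tm_eq tm_eq_of_rule

theorem comp_eq {a b c : K.C.Sys} {f : CITerm K.C a b} {g : CITerm K.C b c}
    {k : CITerm K.C a c} (h : K.AllRules (f.comp g) k) : (tm f).comp (tm g) rfl = tm k :=
  h.elim tm_eq tm_eq_of_rule

theorem eq_comp {a b c : K.C.Sys} {f : CITerm K.C a b} {g : CITerm K.C b c}
    {k : CITerm K.C a c} (h : K.AllRules k (f.comp g)) : tm k = (tm f).comp (tm g) rfl :=
  h.elim tm_eq tm_eq_of_rule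

theorem kern_id (X : FreeMonoid (Type u)) : kern K (Kernel.det fun x : El X => x) = idInf K X :=
  tm_eq (CIRule.inf_id X)

theorem kern_comp {X Y Z : FreeMonoid (Type u)} (f : Kernel X Y) (g : Kernel Y Z) :
    (kern K f).comp (kern K g) rfl = kern K (f.comp g) :=
  (tm_eq (CIRule.inf_comp f g)).symm

theorem kern_mul {X Y Z W : FreeMonoid (Type u)} (f : Kernel X Y) (g : Kernel Z W) :
    kern K f * kern K g = kern K (f.par g) := by
  have := tm_eq (K := K) (CIRule.inf_par f g)
  rw [tm_castHom, tm_par] at this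
  exact this.symm

theorem kern_swap (X Y : FreeMonoid (Type u)) :
    Arr.swap (T := K.theory) (X, 1) (Y, 1) = kern K (SubStoch.swap X Y) := by
  have := tm_eq (K := K) (CIRule.inf_swap X Y)
  rw [tm_castHom, tm_swap] at this
  exact this.symm

theorem idInf_mul (X Y : FreeMonoid (Type u)) : idInf K (X * Y) = idInf K X * idInf K Y := by
  have e : (X * Y, 1) = ((X, 1) * (Y, 1) : K.C.Sys) := Prod.ext rfl (one_mul 1).symm
  exact (congrArg (Arr.idn (T := K.theory)) e).trans (Arr.idn_mul (T := K.theory) _ _)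

@[simp] theorem idInf_one : idInf K 1 = 1 := rfl

@[simp] theorem idCaus_one : idCaus K 1 = 1 := rfl

theorem mixed_swap (X : FreeMonoid (Type u)) (A : K.C.Caus.Sys) :
    Arr.swap (T := K.theory) (X, 1) (1, A) = Arr.idn (T := K.theory) (X, A) := by
  have := tm_eq (K := K) (CIRule.mixed_swap X A)
  rwa [tm_castHom, tm_swap] at this

/-- The rules trivialize only one of the two mixed crossings; the other one is its inverse. -/
theorem mixed_swap' (X : FreeMonoid (Type u)) (A : K.C.Caus.Sys) :
    Arr.swap (T := K.theory) (1, A) (X, 1) = Arr.idn (T := K.theory) (X, A) := by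
  have e : ((X, 1) * (1, A) : K.C.Sys) = (X, A) := Prod.ext (mul_one X) (one_mul A)
  have h1 := Arr.swap_comp_swap (T := K.theory) (X, 1) (1, A)
  have h2 : Arr.idn (T := K.theory) ((X, 1) * (1, A)) = Arr.idn (T := K.theory) (X, A) :=
    congrArg (Arr.idn (T := K.theory)) e
  have h3 := (Arr.comp_congr (mixed_swap X A).symm rfl
    (by exact Prod.ext (one_mul X).symm (mul_one A).symm)).trans (h1.trans h2)
  exact (Arr.idn_comp _ _ _).symm.trans h3

theorem tm_onInf_one {X Y : FreeMonoid (Type u)} (f : Kernel X Y) :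
    tm (CITerm.onInf f (1 : K.C.Caus.Sys)) = kern K f := by
  rw [tm_onInf, idCaus_one, mul_one]

/-- Ignorability. -/
theorem know_ignore (A B : K.C.Caus.Sys) :
    (tm (CITerm.know A B)).comp (tm (CITerm.ignore B)) rfl =
      (kern K (marginal (K.C.Mor A B)) * idCaus K A).comp (tm (CITerm.ignore A))
        (by exact Prod.ext (one_mul 1) (one_mul A)) := by
  have := comp_eq_comp (K := K) (Or.inl (CIRule.know_ignore A B))
  exact this.trans (Arr.comp_congr (tm_onInf _ _) rfl _)

theorem ignore_one : tm (CITerm.ignore (1 : K.C.Caus.Sys)) = 1 :=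
  tm_eq (K := K) CIRule.ignore_one

/-! ### Inferences, and factorization of processes through them -/

/-- A process is an inference. -/
def IsInf (r : Arr K.theory) : Prop :=
  ∃ (X Y : FreeMonoid (Type u)) (k : Kernel X Y), r = kern K k

theorem isInf_kern {X Y : FreeMonoid (Type u)} (k : Kernel X Y) : IsInf (kern K k) :=
  ⟨_, _, k, rfl⟩

theorem isInf_idInf (X : FreeMonoid (Type u)) : IsInf (idInf K X) := ⟨_, _, _, (kern_id X).symm⟩

theorem IsInf.comp {r r' : Arr K.theory} (hr : IsInf r) (hr' : IsInf r') (e : r.tgt = r'.src) :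
    IsInf (r.comp r' e) := by
  obtain ⟨X, Y, k, rfl⟩ := hr
  obtain ⟨Y', Z, k', rfl⟩ := hr'
  obtain rfl : Y = Y' := congrArg Prod.fst e
  exact ⟨_, _, _, kern_comp k k'⟩

theorem IsInf.mul {r r' : Arr K.theory} (hr : IsInf r) (hr' : IsInf r') : IsInf (r * r') := by
  obtain ⟨X, Y, k, rfl⟩ := hr
  obtain ⟨Y', Z, k', rfl⟩ := hr'
  exact ⟨_, _, _, kern_mul k k'⟩

theorem IsInf.exists_kern {r : Arr K.theory} (hr : IsInf r) {X Y : FreeMonoid (Type u)}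
    (hX : r.src = (X, 1)) (hY : r.tgt = (Y, 1)) : ∃ k : Kernel X Y, r = kern K k := by
  obtain ⟨X', Y', k, rfl⟩ := hr
  obtain rfl : X' = X := congrArg Prod.fst hX
  obtain rfl : Y' = Y := congrArg Prod.fst hY
  exact ⟨k, rfl⟩

/-- The process `f` consists of an inference followed by `g`. -/
def Factors (f g : Arr K.theory) : Prop :=
  ∃ r, IsInf r ∧ ∃ e : r.tgt = g.src, f = r.comp g e

namespace Factors

/-- The witness is an identity inference, which is why the source must have no causal part. -/
theorem refl {f : Arr K.theory} {X : FreeMonoid (Type u)} (e : f.src = (X, 1)) : Factors f f :=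
  ⟨idInf K X, isInf_idInf X, e.symm, (Arr.idn_comp _ _ e.symm).symm⟩

theorem trans {f g k : Arr K.theory} (hfg : Factors f g) (hgk : Factors g k) : Factors f k := by
  obtain ⟨r, hr, e, rfl⟩ := hfg
  obtain ⟨r', hr', e', rfl⟩ := hgk
  exact ⟨r.comp r' e, hr.comp hr' _, e', (Arr.comp_assoc _ _ _ _ _).symm⟩

theorem mul {f g f' g' : Arr K.theory} (hfg : Factors f g) (hfg' : Factors f' g') :
    Factors (f * f') (g * g') := by
  obtain ⟨r, hr, e, rfl⟩ := hfg
  obtain ⟨r', hr', e', rfl⟩ := hfg'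
  exact ⟨r * r', hr.mul hr', _, Arr.comp_mul_comp _ _ _ _ _ _⟩

theorem comp {f g : Arr K.theory} (hfg : Factors f g) (k : Arr K.theory) (e : f.tgt = k.src)
    (e' : g.tgt = k.src) : Factors (f.comp k e) (g.comp k e') := by
  obtain ⟨r, hr, e₁, rfl⟩ := hfg
  exact ⟨r, hr, e₁, Arr.comp_assoc _ _ _ _ _⟩

end Factors

/-- Naturality of the swap slides `f` past the wire `X`. At the output the crossing is mixed, hence
immaterial; at the input it is a swap of inferential wires, hence an inference. -/
theorem factors_mul_idInf {f : Arr K.theory} {Z : FreeMonoid (Type u)} {A : K.C.Caus.Sys}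
    (hs : f.src = (Z, 1)) (ht : f.tgt = (1, A)) (X : FreeMonoid (Type u)) :
    Factors (f * idInf K X) (idInf K X * f) := by
  have key := Arr.mul_comp_swap f (idInf K X) ht rfl hs rfl
  refine ⟨kern K (SubStoch.swap Z X), isInf_kern _, ?_, ?_⟩
  · rw [Arr.src_mul, hs]
    exact Prod.ext rfl (one_mul 1).symm
  · refine Eq.trans ?_ (key.trans (Arr.comp_congr (kern_swap Z X) rfl _))
    have := Arr.comp_idn (T := K.theory) (X, A) (f * idInf K X) (by
      rw [Arr.tgt_mul, ht]
      exact Prod.ext (one_mul X) (mul_one A))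
    exact this.symm.trans (Arr.comp_congr rfl (mixed_swap' X A).symm _)

theorem factors_idInf_mul {f : Arr K.theory} {Z : FreeMonoid (Type u)} {A : K.C.Caus.Sys}
    (hs : f.src = (Z, 1)) (ht : f.tgt = (1, A)) (X : FreeMonoid (Type u)) :
    Factors (idInf K X * f) (f * idInf K X) := by
  have key := Arr.mul_comp_swap (idInf K X) f rfl ht rfl hs
  refine ⟨kern K (SubStoch.swap X Z), isInf_kern _, ?_, ?_⟩
  · rw [Arr.src_mul, hs]
    exact Prod.ext rfl (one_mul 1).symm
  · refine Eq.trans ?_ (key.trans (Arr.comp_congr (kern_swap X Z) rfl _))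
    have := Arr.comp_idn (T := K.theory) (X, A) (idInf K X * f) (by
      rw [Arr.tgt_mul, ht]
      exact Prod.ext (mul_one X) (one_mul A))
    exact this.symm.trans (Arr.comp_congr rfl (mixed_swap X A).symm _)

/-! ## Preparation of causal systems -/

/-- Preparation of a causal system, given a process from the trivial system to it. -/
def prepCaus (A : K.C.Caus.Sys) : Arr K.theory := tm (CITerm.know 1 A)

/-- Preparation of the causal part of a system, next to its inferential part. -/
def prep (a : K.C.Sys) : Arr K.theory :=
  ⟨(a.1 * K.C.Mor 1 a.2, 1), a, K.diagram (castHom rfl (by exact Prod.ext (mul_one _) rfl)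
    (CITerm.beside a.1 (CITerm.know 1 a.2)))⟩

theorem prep_eq (a : K.C.Sys) : prep a = idInf K a.1 * prepCaus a.2 :=
  (tm_castHom _ _ _).trans (tm_beside _ _)

theorem prep_one_left (A : K.C.Caus.Sys) : prep (1, A) = prepCaus A := by
  rw [prep_eq, idInf_one, one_mul]

/-- Ignorability for a process with trivial input, where the remaining `⊤` on the trivial system is
the identity. -/
theorem prepCaus_comp_ignore (A : K.C.Caus.Sys) :
    (prepCaus A).comp (tm (CITerm.ignore A)) rfl = kern K (marginal (K.C.Mor 1 A)) := by
  refine (know_ignore 1 A).trans ((Arr.comp_eq_left (a := (1, 1)) ignore_one _).trans ?_)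
  rw [idCaus_one, mul_one]

/-- Ignoring the trivial system may be appended freely, and then `prepCaus_comp_ignore` applies. -/
theorem prepCaus_one :
    prepCaus (1 : K.C.Caus.Sys) = kern K (marginal (K.C.Mor 1 1)) :=
  (Arr.comp_eq_left (a := (1, 1)) ignore_one rfl).symm.trans (prepCaus_comp_ignore 1)

theorem kern_eq_one (k : Kernel.{u} 1 1) (hk : ∀ x, k x = SubDist.pure El.star) :
    kern K k = 1 :=
  (congrArg _ (funext hk)).trans (kern_id 1)

/-- This lets an inferential wire be completed to a preparation of a system with trivial causal
part. -/
theorem point_comp_prepCaus_one :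
    (kern K (point (K.C.Caus.id 1))).comp (prepCaus 1) rfl = 1 := by
  refine (Arr.comp_congr rfl prepCaus_one rfl).trans ((kern_comp _ _).trans ?_)
  exact kern_eq_one _ fun x => SubDist.pure_bind _ _

/-- Preparing a system and applying a known process to it prepares another system. -/
theorem prepCaus_comp_know (A B : K.C.Caus.Sys) :
    (idInf K (K.C.Mor A B) * prepCaus A).comp (tm (CITerm.know A B))
        (by exact Prod.ext (mul_one _) (one_mul _)) =
      (kern K (Kernel.det fun p : El (K.C.Mor A B * K.C.Mor 1 A) => El.single
          (K.C.Caus.comp (El.value (El.snd p)) (El.value (El.fst p))))).comp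
        (prepCaus B) rfl := by
  have h := comp_eq_comp (K := K) (Or.inl (CIRule.know_comp 1 A B))
  exact (Arr.comp_congr ((tm_castHom _ _ _).trans (tm_beside _ _)).symm rfl _).trans
    (h.trans (Arr.comp_congr (tm_onInf_one _) rfl _))

/-- The parallel composite of two states has input `1 * 1`. The proof `h1` used to transport it is
an argument so that it can be `rfl` for functions, where the transport then disappears. -/
theorem prepCaus_mul (A B : K.C.Caus.Sys) (h1 : (1 : K.C.Caus.Sys) = 1 * 1) :
    prepCaus A * prepCaus B =
      (kern K (Kernel.det fun p : El (K.C.Mor 1 A * K.C.Mor 1 B) => El.single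
          (castHom h1.symm rfl (K.C.Caus.par (El.value (El.fst p)) (El.value (El.snd p)))))).comp
        (prepCaus (A * B)) rfl := by
  have h := eq_comp (K := K) (Or.inl (CIRule.know_par 1 A 1 B))
  refine ((tm_castHom _ _ _).symm.trans h).trans ?_
  -- Replacing `1 * 1` by a variable `o` allows substitution along `1 = o`.
  have key : ∀ (o : K.C.Caus.Sys) (h1 : 1 = o) (Z : FreeMonoid (Type u))
      (φ : El Z → K.C.Caus.Proc o (A * B)),
      (tm (CITerm.onInf (Kernel.det fun p => El.single (φ p)) o)).comp
        (tm (CITerm.know o (A * B))) rfl =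
      (kern K (X := Z) (Y := K.C.Mor 1 (A * B))
        (Kernel.det fun p => El.single (castHom h1.symm rfl (φ p)))).comp
          (prepCaus (A * B)) rfl := by
    rintro _ rfl Z φ
    exact Arr.comp_congr (tm_onInf_one _) rfl _
  exact key _ h1 _ _

/-- After `r`, the identity of the trivial causal system is supplied by a point distribution and
prepared; by `point_comp_prepCaus_one` this has no effect. -/
theorem factors_prep_one {r : Arr K.theory} (hr : IsInf r) {Y : FreeMonoid (Type u)}
    (hY : r.tgt = (Y, 1)) : Factors r (prep (Y, 1)) := by
  have e : (idInf K Y * kern K (point (K.C.Caus.id 1))).comp (prep (Y, 1))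
      (by exact Prod.ext rfl (one_mul 1)) = idInf K Y := by
    refine (Arr.comp_congr rfl (prep_eq _) _).trans ?_
    refine (Arr.comp_mul_comp _ _ _ _ rfl rfl).symm.trans ?_
    rw [point_comp_prepCaus_one, mul_one]
    exact Arr.comp_idn _ _ _
  have h : Factors (idInf K Y) (prep (Y, 1)) :=
    ⟨_, (isInf_idInf Y).mul (isInf_kern _), _, e.symm⟩
  refine Factors.trans ⟨r, hr, hY, ?_⟩ h
  exact (Arr.comp_idn _ _ _).symm

theorem isInf_prep_one (X : FreeMonoid (Type u)) : IsInf (prep ((X, 1) : K.C.Sys)) := by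
  rw [prep_eq, prepCaus_one]
  exact (isInf_idInf X).mul (isInf_kern _)

theorem prep_comp_kern_mul {X Y : FreeMonoid (Type u)} (f : Kernel X Y) (A : K.C.Caus.Sys) :
    (prep (X, A)).comp (kern K f * idCaus K A)
      (by exact Prod.ext (mul_one _).symm (one_mul _).symm) = kern K f * prepCaus A :=
  (Arr.comp_congr (prep_eq _) rfl _).trans ((Arr.comp_mul_comp _ _ _ _ rfl rfl).symm.trans
    (congrArg₂ (· * ·) (Arr.comp_eq_right (f := idInf K X) (a := (X, 1)) rfl rfl)
      (Arr.comp_eq_left (g := idCaus K A) (a := (1, A)) rfl rfl)))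

/-- The kernel by which `κ` fed with `f` acts on prepared states: sample a process from `f` and
compose it with the state. At the end this is used for `f = Ξ`. -/
theorem prep_comp_onInf_comp_know {X : FreeMonoid (Type u)} {A B : K.C.Caus.Sys}
    (f : Kernel X (K.C.Mor A B)) :
    (prep (X, A)).comp (tm ((CITerm.onInf f A).comp (CITerm.know A B))) rfl =
      (kern K ((f.par (Kernel.det fun x : El (K.C.Mor 1 A) => x)).comp
        (Kernel.det fun p : El (K.C.Mor A B * K.C.Mor 1 A) => El.single
          (K.C.Caus.comp (El.value (El.snd p)) (El.value (El.fst p)))))).comp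
        (prepCaus B) rfl := by
  have e : (prep (X, A)).comp (tm (CITerm.onInf f A)) rfl =
      (kern K (f.par (Kernel.det fun x : El (K.C.Mor 1 A) => x))).comp
        (idInf K (K.C.Mor A B) * prepCaus A) (by exact Prod.ext rfl (one_mul 1).symm) := by
    refine (Arr.comp_congr rfl (tm_onInf f A) _).trans ((prep_comp_kern_mul f A).trans ?_)
    have e' : kern K (f.par (Kernel.det fun x : El (K.C.Mor 1 A) => x)) =
        kern K f * idInf K (K.C.Mor 1 A) :=
      (kern_mul _ _).symm.trans (congrArg (_ * ·) (kern_id _))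
    refine Eq.trans ?_ (Arr.comp_congr e' rfl _).symm
    refine Eq.trans ?_ (Arr.comp_mul_comp _ _ _ _ rfl rfl)
    exact congrArg₂ (· * ·)
      (Arr.comp_eq_left (g := idInf K (K.C.Mor A B)) (a := (K.C.Mor A B, 1)) rfl rfl).symm
      (Arr.comp_eq_right (f := idInf K (K.C.Mor 1 A)) (a := (K.C.Mor 1 A, 1)) rfl rfl).symm
  exact (Arr.comp_assoc _ _ _ rfl rfl).symm.trans ((Arr.comp_congr e rfl _).trans
    ((Arr.comp_assoc _ _ _ _ _).trans ((Arr.comp_congr rfl (prepCaus_comp_know A B) _).trans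
      ((Arr.comp_assoc _ _ _ rfl rfl).symm.trans (Arr.comp_congr (kern_comp _ _) rfl _)))))

end CITheory

/-! ## Classical realist processes acting on prepared ontic states -/

namespace CITheory

theorem IsInf.of_eq_kern {K : CITheory.{s, u}} {r : Arr K.theory} {X Y : FreeMonoid (Type u)}
    {k : Kernel X Y} (e : r = kern K k) : IsInf r := ⟨_, _, k, e⟩

theorem IsInf.tm_comp {K : CITheory.{s, u}} {a b c : K.C.Sys} {f : CITerm K.C a b}
    {g : CITerm K.C b c} (hf : IsInf (tm f)) (hg : IsInf (tm g)) : IsInf (tm (f.comp g)) :=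
  hf.comp hg rfl

theorem Factors.of_eq {K : CITheory.{s, u}} {f f' g : Arr K.theory} (e : f = f')
    (h : Factors f' g) : Factors f g := e ▸ h

/-- The value set of the trivial system is itself trivial, so marginalizing it is the identity and
`learn_marginal` gives the claim. -/
theorem learn_one : tm (K := classicalRealist.{u}) (CITerm.learn (C := functional) 1) = 1 := by
  have h := comp_eq (K := classicalRealist.{u})
    (Or.inl (CIRule.learn_marginal (C := functional) (1 : finiteSystems.{u})))
  refine (Arr.comp_eq_left (T := classicalRealist.{u}.theory) (a := (1, 1)) ?_ rfl).symm.trans h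
  exact (tm_onInf_one (K := classicalRealist) _).trans (kern_eq_one _ fun x => rfl)

/-- The propagation rule with trivial input: learning about the prepared state `f` returns `f(*)`
and keeps `f` for the preparation. Knowledge gained about the trivial input is void by `learn_one`,
so what precedes the preparation is an inference. -/
theorem prepCaus_comp_learn (M : finiteSystems.{u}) :
    Factors ((prepCaus (K := classicalRealist) M).comp
      (tm (K := classicalRealist) (CITerm.learn (C := functional) M)) rfl)
      (prep (K := classicalRealist) (M.1, M)) := by
  have h := comp_eq_comp (K := classicalRealist.{u}) (Or.inr (PropagationRule.propagate 1 M))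
  refine ⟨_, ?_, ?_, h.trans (Arr.comp_congr rfl ?_ ?_)⟩
  · refine IsInf.tm_comp (K := classicalRealist) ?_ ?_
    · have e : tm (K := classicalRealist.{u}) (CITerm.beside (functional.Mor 1 M)
          (CITerm.learn (C := functional) 1)) = idInf classicalRealist (functional.Mor 1 M) :=
        (tm_beside (K := classicalRealist) _ _).trans
          ((congrArg (_ * ·) learn_one).trans (mul_one _))
      exact ((tm_castHom (K := classicalRealist) _ _ _).trans e) ▸ isInf_idInf _
    · exact IsInf.of_eq_kern (tm_onInf_one (K := classicalRealist) _)
  · rfl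
  · rfl
  · rfl

theorem prepCaus_mul_factors (Λ M : finiteSystems.{u}) :
    Factors (prepCaus (K := classicalRealist) Λ * prepCaus (K := classicalRealist) M)
      (prepCaus (K := classicalRealist) (Λ * M)) :=
  ⟨_, isInf_kern _, _, prepCaus_mul (K := classicalRealist) Λ M rfl⟩

/-- This is where functions matter: a function `1 → Λ × M` is a pair of functions, so an inference
can split a joint state into its components before preparation. The inference of `prepCaus_mul`
reassembles them. -/
theorem factors_prepCaus_mul (Λ M : finiteSystems.{u}) :
    Factors (prepCaus (K := classicalRealist) (Λ * M))
      (prepCaus (K := classicalRealist) Λ * prepCaus (K := classicalRealist) M) := by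
  refine ⟨kern classicalRealist (X := functional.Mor 1 (Λ * M))
    (Y := functional.Mor 1 Λ * functional.Mor 1 M) (Kernel.det fun φ => El.join
      (El.single (fun x => El.fst ((El.value φ : El 1 → El (Λ.1 * M.1)) x)))
      (El.single (fun x => El.snd ((El.value φ : El 1 → El (Λ.1 * M.1)) x)))), isInf_kern _,
    rfl, ?_⟩
  refine Eq.symm ((Arr.comp_congr rfl (prepCaus_mul (K := classicalRealist) Λ M rfl) _).trans
    ((Arr.comp_assoc _ _ _ rfl rfl).symm.trans ?_))
  -- It remains that splitting a state and pairing the components again is the identity inference.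
  refine Arr.comp_eq_right (a := (functional.Mor 1 (Λ * M), 1)) ?_ rfl
  refine (kern_comp _ _).trans (Eq.trans (congrArg _ ?_) (kern_id _))
  funext φ
  refine (SubDist.pure_bind _ _).trans (congrArg SubDist.pure ?_)
  refine (congrArg El.single (congrArg₂
    (fun (f : functional.Caus.Proc 1 Λ) (g : functional.Caus.Proc 1 M) =>
      (functional.Caus.par f g : functional.Caus.Proc 1 (Λ * M)))
    (congrArg El.value (El.fst_join _ _)) (congrArg El.value (El.snd_join _ _)))).trans ?_
  exact Prod.ext (funext fun x => El.join_fst_snd _) rfl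

/-! ### Action on prepared systems, and its stability under forming diagrams -/

section

variable {K : CITheory.{s, u}}

/-- The inferential wire of `b` slides past the preparation of `a.2`; then the two causal
preparations are adjacent and `h` merges them. `factors_prep_mul` is the reverse. -/
theorem prep_mul_factors {a b : K.C.Sys}
    (h : Factors (prepCaus a.2 * prepCaus b.2) (prepCaus (K := K) (a.2 * b.2))) :
    Factors (prep a * prep b) (prep (K := K) (a * b)) := by
  have h1 : Factors (idInf K a.1 * (prepCaus a.2 * idInf K b.1) * prepCaus b.2)
      (idInf K a.1 * (idInf K b.1 * prepCaus a.2) * prepCaus b.2) :=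
    ((Factors.refl rfl).mul (factors_mul_idInf rfl rfl _)).mul (Factors.refl rfl)
  have h2 : Factors ((idInf K a.1 * idInf K b.1) * (prepCaus a.2 * prepCaus b.2))
      ((idInf K a.1 * idInf K b.1) * prepCaus (a.2 * b.2)) :=
    ((Factors.refl rfl).mul (Factors.refl rfl)).mul h
  rw [prep_eq, prep_eq, prep_eq, Prod.fst_mul, Prod.snd_mul, idInf_mul]
  simp only [mul_assoc] at h1 h2 ⊢
  exact h1.trans h2

theorem factors_prep_mul {a b : K.C.Sys}
    (h : Factors (prepCaus (K := K) (a.2 * b.2)) (prepCaus a.2 * prepCaus b.2)) :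
    Factors (prep (K := K) (a * b)) (prep a * prep b) := by
  have h1 : Factors (idInf K a.1 * (idInf K b.1 * prepCaus a.2) * prepCaus b.2)
      (idInf K a.1 * (prepCaus a.2 * idInf K b.1) * prepCaus b.2) :=
    ((Factors.refl rfl).mul (factors_idInf_mul rfl rfl _)).mul (Factors.refl rfl)
  have h2 : Factors ((idInf K a.1 * idInf K b.1) * prepCaus (a.2 * b.2))
      ((idInf K a.1 * idInf K b.1) * (prepCaus a.2 * prepCaus b.2)) :=
    ((Factors.refl rfl).mul (Factors.refl rfl)).mul h
  rw [prep_eq, prep_eq, prep_eq, Prod.fst_mul, Prod.snd_mul, idInf_mul]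
  simp only [mul_assoc] at h1 h2 ⊢
  exact h2.trans h1

/-- On prepared systems, `f` acts by an inference. -/
def ActsByInf (f : Arr K.theory) : Prop :=
  Factors ((prep f.src).comp f rfl) (prep f.tgt)

namespace ActsByInf

theorem one (a : K.C.Sys) : ActsByInf (Arr.idn (T := K.theory) a) :=
  (Factors.refl (f := prep a) rfl).of_eq (Arr.comp_idn _ _ _)

theorem comp {f g : Arr K.theory} (hf : ActsByInf f) (hg : ActsByInf g) (e : f.tgt = g.src) :
    ActsByInf (f.comp g e) := by
  obtain ⟨a, b, f⟩ := f
  obtain ⟨b', c, g⟩ := g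
  obtain rfl : b = b' := e
  exact ((Factors.comp hf ⟨b, c, g⟩ rfl rfl).trans hg).of_eq (Arr.comp_assoc _ _ _ _ _).symm

/-- The comparisons `hs` and `ht` of joint with separate preparation are kept as hypotheses because
the splitting is proved only for the functional theory. -/
theorem mul {f g : Arr K.theory} (hf : ActsByInf f) (hg : ActsByInf g)
    (hs : Factors (prep (K := K) (f.src * g.src)) (prep (K := K) f.src * prep (K := K) g.src))
    (ht : Factors (prep (K := K) f.tgt * prep (K := K) g.tgt) (prep (K := K) (f.tgt * g.tgt))) :
    ActsByInf (f * g) := by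
  exact (hs.comp (f * g) rfl rfl).trans
    (((Factors.mul hf hg).of_eq (Arr.comp_mul_comp _ _ _ _ _ _).symm).trans ht)

theorem swap {a b : K.C.Sys}
    (hs : Factors (prep (K := K) (a * b)) (prep (K := K) a * prep (K := K) b))
    (ht : Factors (prep (K := K) b * prep (K := K) a) (prep (K := K) (b * a))) :
    ActsByInf (Arr.swap (T := K.theory) a b) := by
  have h := Arr.mul_comp_swap (prep a) (prep b) rfl rfl rfl rfl
  refine (hs.comp (Arr.swap (T := K.theory) a b) rfl rfl).trans (Factors.trans ?_ ht)
  exact ⟨_, IsInf.of_eq_kern (kern_swap _ _), _, h⟩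

/-- Preparing a system without causal part is an inference, so the whole composite is one. -/
theorem kern {X Y : FreeMonoid (Type u)} (k : Kernel X Y) : ActsByInf (kern K k) :=
  factors_prep_one ((isInf_prep_one X).comp (isInf_kern k) _) rfl

theorem know (A B : K.C.Caus.Sys) : ActsByInf (tm (K := K) (CITerm.know A B)) := by
  have e : (prep (K.C.Mor A B, A)).comp (tm (K := K) (CITerm.know A B)) rfl = _ :=
    (Arr.comp_congr (prep_eq _) rfl _).trans (prepCaus_comp_know A B)
  have h : Factors ((prep (K.C.Mor A B, A)).comp (tm (K := K) (CITerm.know A B)) rfl)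
    (prepCaus B) := ⟨_, isInf_kern _, _, e⟩
  rw [← prep_one_left] at h
  exact h

theorem ignore (A : K.C.Caus.Sys) : ActsByInf (tm (K := K) (CITerm.ignore A)) := by
  refine factors_prep_one ?_ rfl
  exact IsInf.of_eq_kern ((Arr.comp_congr (prep_one_left A) rfl _).trans (prepCaus_comp_ignore A))

end ActsByInf

end

/-- Every classical realist process acts on prepared ontic states by an inference. -/
theorem actsByInf_tm {a b : classicalRealist.{u}.C.Sys} (f : CITerm classicalRealist.{u}.C a b) :
    ActsByInf (tm f) := by
  induction f with
  | gen g =>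
    cases g with
    | inf k => exact .kern k
    | know A B => exact .know A B
    -- This case rests on the propagation rule, and `par` and `swap` rest on splitting joint states;
    -- the other cases hold in every causal-inferential theory.
    | learn M =>
      exact (prepCaus_comp_learn M).of_eq
        (Arr.comp_congr (prep_one_left (K := classicalRealist) M) rfl _)
    | ignore A => exact .ignore A
  | id a => exact .one a
  | comp f g hf hg => exact hf.comp hg rfl
  | par f g hf hg =>
    exact hf.mul hg (factors_prep_mul (factors_prepCaus_mul _ _))
      (prep_mul_factors (prepCaus_mul_factors _ _))
  | swap a b =>
    exact .swap (factors_prep_mul (factors_prepCaus_mul _ _))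
      (prep_mul_factors (prepCaus_mul_factors _ _))

theorem actsByInf (f : Arr classicalRealist.{u}.theory) : ActsByInf f := by
  obtain ⟨a, b, f⟩ := f
  induction f using Quotient.inductionOn with
  | _ f => exact actsByInf_tm f

end CITheory

/-! ## Products of finite families of distributions -/

namespace SubDist

variable {A B C : Type u}

theorem mass_bind (d : SubDist A) (k : A → SubDist B) :
    (d.bind k).mass = d.1.sum fun a r => r * (k a).mass :=
  mass_sum d.1 fun a => (k a).1

@[simp] theorem mass_pure (a : A) : (pure a).mass = 1 := by
  simp [mass, pure]

theorem mass_bind_of_mass_eq_one (d : SubDist A) {k : A → SubDist B} (hk : ∀ a, (k a).mass = 1) :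
    (d.bind k).mass = d.mass := by
  rw [mass_bind]
  exact Finsupp.sum_congr fun a _ => by rw [hk, mul_one]

/-- Discarding a draw costs nothing only when it is normalized; `exists_joint` needs stochasticity
for this reason. -/
theorem bind_const {d : SubDist A} (hd : d.mass = 1) (e : SubDist B) :
    (d.bind fun _ => e) = e := by
  apply Subtype.ext
  change (d.1.sum fun _ r => r • e.1) = e.1
  rw [Finsupp.sum, ← Finset.sum_smul, show ∑ a ∈ d.1.support, d.1 a = 1 from hd, one_smul]

/-- Finitely many distributions are the marginals of a joint distribution. -/
theorem exists_joint {B : Type u} (ι : Type u) [Finite ι] :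
    ∀ d : ι → SubDist B, (∀ i, (d i).mass = 1) →
      ∃ D : SubDist (ι → B), D.mass = 1 ∧ ∀ i, (D.bind fun g => pure (g i)) = d i := by
  induction ι using Finite.induction_empty_option with
  | of_equiv e ih =>
    intro d hd
    obtain ⟨D, hD, h⟩ := ih (fun i => d (e i)) fun i => hd _
    refine ⟨D.bind fun g => pure fun i => g (e.symm i), ?_, fun i => ?_⟩
    · rw [mass_bind_of_mass_eq_one _ fun _ => mass_pure _, hD]
    · simpa [bind_bind, pure_bind] using h (e.symm i)
  -- With no marginals to match, a distribution of mass one is still required: the point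
  -- distribution on the empty function.
  | h_empty => exact fun d hd => ⟨pure PEmpty.elim, mass_pure _, fun i => i.elim⟩
  | h_option ih =>
    intro d hd
    obtain ⟨D, hD, h⟩ := ih (fun i => d (some i)) fun i => hd _
    -- The value at the new index is drawn independently of the others. Either marginal is
    -- unaffected by the other factor, by `bind_const`.
    refine ⟨(d none).bind fun b => D.bind fun g => pure fun i => i.elim b g, ?_, fun i => ?_⟩
    · rw [mass_bind_of_mass_eq_one _ fun b => ?_, hd]
      rw [mass_bind_of_mass_eq_one _ fun _ => mass_pure _, hD]
    · cases i with
      | none => simp [bind_bind, pure_bind, bind_const hD, bind_pure]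
      | some i => simp [bind_bind, pure_bind, h, bind_const (hd none)]

end SubDist

theorem finite_listProd : ∀ X : List (Type u), (∀ A ∈ X, Finite A) → Finite (listProd X)
  | [], _ => inferInstanceAs (Finite PUnit)
  | A :: X, h => by
    have := h A (by simp)
    have := finite_listProd X fun B hB => h B (by simp [hB])
    exact inferInstanceAs (Finite (A × listProd X))

instance (Λ : finiteSystems.{u}) : Finite (El Λ.1) := finite_listProd _ Λ.2

/-! ## Predictions of inferences -/

namespace CITheory

/-- The equality is heterogeneous because `p` sends `(X, 1)` to `X` only propositionally. -/
theorem Prediction.map_i {K : CITheory.{s, u}} (P : K.Prediction) {X Y : FreeMonoid (Type u)}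
    (k : Kernel X Y) :
    HEq (P.p.map (a := ⟨(X, 1), rfl⟩) (b := ⟨(Y, 1), rfl⟩) (K.i.map (a := X) (b := Y) k)) k :=
  DPMap.map_heq_of_eq P.p_i (a := X) (b := Y) k

/-- Equivalent closed processes have equal predictions, and inferences are their own predictions; so
the quotient does not identify distinct kernels. -/
theorem Prediction.kernel_eq {K : CITheory.{s, u}} (P : K.Prediction)
    {X Y : FreeMonoid (Type u)} {k k' : Kernel X Y}
    (e : InfEquiv P.p (K.i.map (a := X) (b := Y) k) (K.i.map (a := X) (b := Y) k')) : k = k' := by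
  have h := InfEquiv.map_eq (p := P.p) (a := ⟨(X, 1), rfl⟩) (b := ⟨(Y, 1), rfl⟩) e
  exact eq_of_heq ((P.map_i k).symm.trans ((heq_of_eq h).trans (P.map_i k')))

/-! ## Classical realist processes are determined by their action on ontic states -/

section Ontic

/-- The purely inferential input of `x` can be rewritten as a preparation by `factors_prep_one`,
after which `actsByInf` applies. -/
theorem factors_prep {x : Arr classicalRealist.{u}.theory} {X : FreeMonoid (Type u)}
    (hX : x.src = (X, 1)) : Factors x (prep x.tgt) := by
  have h := (factors_prep_one (isInf_idInf (K := classicalRealist) X) rfl).comp x hX.symm hX.symm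
  refine (h.of_eq (Arr.idn_comp _ _ _).symm).trans ?_
  obtain ⟨a, b, x⟩ := x
  obtain rfl : a = (X, 1) := hX
  exact actsByInf _

/-- By `factors_prep`, `x` is an inference followed by a preparation whose causal part is trivial,
which is again an inference. -/
theorem isInf_of_closed {x : Arr classicalRealist.{u}.theory} {X Y : FreeMonoid (Type u)}
    (hX : x.src = (X, 1)) (hY : x.tgt = (Y, 1)) : IsInf x := by
  obtain ⟨r, hr, e, h⟩ := factors_prep hX
  rw [h]
  refine hr.comp ?_ _
  rw [hY]
  exact isInf_prep_one Y

theorem exists_kern {X Y : FreeMonoid (Type u)}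
    (x : classicalRealist.{u}.theory.Proc (X, 1) (Y, 1)) :
    ∃ k : Kernel X Y, x = classicalRealist.i.map (a := X) (b := Y) k := by
  obtain ⟨k, hk⟩ := (isInf_of_closed (x := ⟨_, _, x⟩) rfl rfl).exists_kern rfl rfl
  exact ⟨k, Arr.mk_inj hk⟩

/-- The first half `x` of a tester starts from a closed system, so it is an inference followed by
separate preparations of `a` and `W`. Thus a tester sees `f` only through its composite with `prep
a`. -/
theorem infEquiv_of_prep_comp_eq (P : classicalRealist.{u}.Prediction)
    {a b : classicalRealist.{u}.theory.Sys} {f g : classicalRealist.{u}.theory.Proc a b}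
    (h : (prep a).comp ⟨a, b, f⟩ rfl = (prep a).comp ⟨a, b, g⟩ rfl) : InfEquiv P.p f g := by
  intro c d W x y
  obtain ⟨⟨X, o⟩, hc⟩ := c
  obtain rfl : o = 1 := hc
  -- The prediction map and the second half of the tester are common to both sides; the diagrams
  -- already agree before `y`.
  congr 1
  unfold test
  congr 1
  have hx := (factors_prep (x := ⟨_, _, x⟩) rfl).trans
    (factors_prep_mul (a := a) (b := W) (factors_prepCaus_mul _ _))
  obtain ⟨r, hr, e, hx⟩ := hx
  apply Arr.mk_inj
  have key : ∀ k : classicalRealist.{u}.theory.Proc a b,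
      Arr.comp ⟨(X, 1), a * W, x⟩ (⟨a, b, k⟩ * Arr.idn W) rfl =
        r.comp ((prep a).comp ⟨a, b, k⟩ rfl * (prep W).comp (Arr.idn W) rfl) e := by
    intro k
    refine (Arr.comp_congr hx rfl _).trans ((Arr.comp_assoc _ _ _ _ _).trans ?_)
    exact Arr.comp_congr rfl (Arr.comp_mul_comp _ _ _ _ _ _).symm _
  exact (key f).trans ((Arr.comp_congr rfl (congrArg (· * _) h) _).trans (key g).symm)

end Ontic

end CITheory

/-! ## Classical realist representations -/

namespace CITheory.Prediction

/-- The quotient map, on bundled processes. -/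
def quotArr {K : CITheory.{s, u}} (P : K.Prediction) : Arr K.theory →* Arr P.QuotTheory :=
  (toQuot P.p).arr

theorem quotArr_comp {K : CITheory.{s, u}} (P : K.Prediction) (f g : Arr K.theory)
    (e : f.tgt = g.src) : P.quotArr (f.comp g e) = (P.quotArr f).comp (P.quotArr g) e :=
  (toQuot P.p).arr_comp f g e

end CITheory.Prediction

namespace Representation

open CITheory

variable {L : Laboratory.{u}} {P : (operational L).Prediction}
  {P' : classicalRealist.{u}.Prediction} (ξ : Representation P P')

/-- On systems, both prediction maps send `(X, 1)` to `X`. Since the image of `(X, 1)` has no causal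
part, preservation of predictions determines it. -/
theorem obj_inf (X : FreeMonoid (Type u)) :
    ξ.obj ((X, 1) : (operational L).C.Sys) = ((X, 1) : classicalRealist.C.Sys) := by
  have hP : P.p.obj ⟨(X, 1), rfl⟩ = X :=
    DFunLike.congr_fun (congrArg DPMap.obj P.p_i) X
  have h : P'.p.obj ⟨ξ.obj ((X, 1) : (operational L).C.Sys), ξ.closed_of_closed _ rfl⟩ = X :=
    (DFunLike.congr_fun (congrArg DPMap.obj ξ.predictions) ⟨(X, 1), rfl⟩).trans hP
  have key : ∀ (a : classicalRealist.{u}.C.Sys) (ha : a.2 = 1), P'.p.obj ⟨a, ha⟩ = X →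
      a = (X, 1) := by
    rintro ⟨Y, o⟩ ha hX
    have ho : o = 1 := ha
    subst ho
    have hP' : P'.p.obj ⟨(Y, 1), rfl⟩ = Y :=
      DFunLike.congr_fun (congrArg DPMap.obj P'.p_i) Y
    exact Prod.ext (hP'.symm.trans hX) rfl
  exact key _ (ξ.closed_of_closed _ rfl) h

/-- A representation sends every inference to itself. -/
theorem arr_kern {X Y : FreeMonoid (Type u)} (f : Kernel X Y) :
    ξ.arr (P.quotArr (kern (operational L) f)) = P'.quotArr (kern classicalRealist f) := by
  have hf : HEq (P'.pQ.map
      (a := ⟨ξ.obj ((X, 1) : (operational L).C.Sys), ξ.closed_of_closed _ rfl⟩)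
      (b := ⟨ξ.obj ((Y, 1) : (operational L).C.Sys), ξ.closed_of_closed _ rfl⟩)
      (ξ.map (P.cls (CITerm.inf f)))) f :=
    (DPMap.map_heq_of_eq ξ.predictions (a := ⟨(X, 1), rfl⟩) (b := ⟨(Y, 1), rfl⟩)
      (P.cls (CITerm.inf f))).trans (P.map_i f)
  obtain ⟨t, ht⟩ : ∃ t : P'.QuotTheory.Proc (X, 1) (Y, 1),
      HEq (ξ.map (P.cls (CITerm.inf f))) t :=
    ⟨castHom (ξ.obj_inf X) (ξ.obj_inf Y) _, (castHom_heq _ _ _).symm⟩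
  obtain ⟨t, rfl⟩ := Quotient.exists_rep t
  -- A representative of the image is closed, hence itself an inference `k`; its prediction is both
  -- `k` and `f`.
  obtain ⟨k, rfl⟩ := exists_kern t
  have hk := (DPMap.map_heq P'.pQ
    (a := ⟨ξ.obj ((X, 1) : (operational L).C.Sys), ξ.closed_of_closed _ rfl⟩)
    (b := ⟨ξ.obj ((Y, 1) : (operational L).C.Sys), ξ.closed_of_closed _ rfl⟩)
    (a' := ⟨(X, 1), rfl⟩) (b' := ⟨(Y, 1), rfl⟩)
    (Subtype.ext (ξ.obj_inf X)) (Subtype.ext (ξ.obj_inf Y)) ht).trans (P'.map_i k)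
  obtain rfl : k = f := eq_of_heq (hk.symm.trans hf)
  exact Arr.mk_eq (ξ.obj_inf X) (ξ.obj_inf Y) ht

theorem arr_idCaus (A : L.Caus.Sys) :
    ξ.arr (P.quotArr (idCaus (operational L) A)) =
      P'.quotArr (idCaus classicalRealist (ξ.space A)) :=
  (ξ.arr_idn _).trans (congrArg Arr.idn (ξ.obj_causal A))

theorem arr_ignore (A : L.Caus.Sys) :
    ξ.arr (P.quotArr (tm (K := operational L) (CITerm.ignore A))) =
      P'.quotArr (tm (K := classicalRealist) (CITerm.ignore (ξ.space A))) :=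
  Arr.mk_eq (ξ.obj_causal A) (ξ.obj_inf 1) (ξ.ignorability A)

/-- Both factors of `(X, A) = (X, 1) * (1, A)` have known images. -/
theorem obj_mk (X : FreeMonoid (Type u)) (A : L.Caus.Sys) :
    ξ.obj ((X, A) : (operational L).C.Sys) = ((X, ξ.space A) : classicalRealist.C.Sys) := by
  have e : ((X, A) : (operational L).C.Sys) =
      ((X, 1) : (operational L).C.Sys) * ((1, A) : (operational L).C.Sys) :=
    Prod.ext (mul_one X).symm (one_mul A).symm
  refine (congrArg ξ.obj e).trans ((map_mul ξ.obj _ _).trans ?_)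
  refine (congrArg₂ (· * ·) (ξ.obj_inf X) (ξ.obj_causal A)).trans ?_
  exact Prod.ext (mul_one X) (one_mul _)

theorem arr_quotArr_comp (f g : Arr (operational L).theory) (e : f.tgt = g.src) :
    ξ.arr (P.quotArr (f.comp g e)) =
      (ξ.arr (P.quotArr f)).comp (ξ.arr (P.quotArr g)) (congrArg ξ.obj e) :=
  (congrArg ξ.arr (P.quotArr_comp f g e)).trans (ξ.arr_comp _ _ _)

/-- A representative of the image of `κ` inherits ignorability in the quotient. -/
theorem quotArr_comp_ignore (A B : L.Caus.Sys)
    (t : classicalRealist.theory.Proc ((operational L).C.Mor A B, ξ.space A) (1, ξ.space B))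
    (ht : ξ.arr (P.quotArr (tm (K := operational L) (CITerm.know A B))) =
      P'.quotArr ⟨_, _, t⟩) :
    P'.quotArr (Arr.comp ⟨_, _, t⟩
        (tm (K := classicalRealist) (CITerm.ignore (ξ.space B))) rfl) =
      P'.quotArr ((kern classicalRealist (marginal ((operational L).C.Mor A B)) *
        idCaus classicalRealist (ξ.space A)).comp
          (tm (K := classicalRealist) (CITerm.ignore (ξ.space A))) rfl) := by
  have h := congrArg (fun f => ξ.arr (P.quotArr f)) (know_ignore (K := operational L) A B)
  refine (P'.quotArr_comp _ _ _).trans (Eq.trans ?_ (P'.quotArr_comp _ _ _).symm)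
  refine (Arr.comp_congr ht.symm (ξ.arr_ignore B).symm _).trans ((ξ.arr_quotArr_comp _ _ _).symm.trans
    (h.trans ((ξ.arr_quotArr_comp _ _ _).trans ?_)))
  refine Arr.comp_congr ?_ (ξ.arr_ignore A) _
  refine (congrArg ξ.arr (map_mul P.quotArr _ _)).trans ((map_mul ξ.arr _ _).trans
    (Eq.trans ?_ (map_mul P'.quotArr _ _).symm))
  exact congrArg₂ (· * ·) (ξ.arr_kern _) (ξ.arr_idCaus A)

/-- A process that inherits ignorability acts on prepared ontic states stochastically. -/
theorem exists_isStochastic (P' : classicalRealist.{u}.Prediction) (X : FreeMonoid (Type u))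
    (Λ M : finiteSystems.{u})
    (t : classicalRealist.{u}.theory.Proc (X, Λ) (1, M))
    (ht : P'.quotArr (Arr.comp ⟨_, _, t⟩
        (tm (K := classicalRealist) (CITerm.ignore (C := functional) M)) rfl) =
      P'.quotArr ((kern classicalRealist (marginal X) * idCaus classicalRealist Λ).comp
          (tm (K := classicalRealist) (CITerm.ignore (C := functional) Λ)) rfl)) :
    ∃ k : Kernel (X * functional.Mor 1 Λ) (functional.Mor 1 M), IsStochastic k ∧
      (prep (K := classicalRealist) (X, Λ)).comp ⟨_, _, t⟩ rfl =
        (kern classicalRealist k).comp (prepCaus (K := classicalRealist) M) rfl := by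
  obtain ⟨r, hr, e, h⟩ := actsByInf (⟨_, _, t⟩ : Arr classicalRealist.{u}.theory)
  obtain ⟨k, rfl⟩ := hr.exists_kern (X := X * functional.Mor 1 Λ) (Y := functional.Mor 1 M)
    (congrArg Arr.src h).symm e
  have h' : (prep (K := classicalRealist) (X, Λ)).comp ⟨_, _, t⟩ rfl =
        (kern classicalRealist k).comp (prepCaus (K := classicalRealist) M) rfl :=
    h.trans (Arr.comp_congr rfl (prep_one_left (K := classicalRealist) M) _)
  refine ⟨k, ?_, h'⟩
  have e1 : ((prep (K := classicalRealist) (X, Λ)).comp ⟨_, _, t⟩ rfl).comp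
      (tm (K := classicalRealist) (CITerm.ignore (C := functional) M)) rfl =
      kern classicalRealist (k.comp (marginal (functional.Mor 1 M))) :=
    (Arr.comp_congr h' rfl _).trans ((Arr.comp_assoc _ _ _ rfl rfl).trans
      ((Arr.comp_congr rfl (prepCaus_comp_ignore (K := classicalRealist) M) rfl).trans
        (kern_comp _ _)))
  have e2 : (prep (K := classicalRealist) (X, Λ)).comp
      ((kern classicalRealist (marginal X) * idCaus classicalRealist Λ).comp
        (tm (K := classicalRealist) (CITerm.ignore (C := functional) Λ)) rfl)
        (by exact Prod.ext (mul_one _).symm (one_mul _).symm) =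
      kern classicalRealist ((marginal X).par (marginal (functional.Mor 1 Λ))) := by
    refine (Arr.comp_assoc _ _ _ _ rfl).symm.trans ?_
    -- Writing `⊤` as `1 * ⊤` brings the composite into the form required by the interchange law.
    have e4 : (1 : Arr classicalRealist.{u}.theory) *
        (tm (K := classicalRealist) (CITerm.ignore (C := functional) Λ)) =
        (tm (K := classicalRealist) (CITerm.ignore (C := functional) Λ)) := one_mul _
    refine (Arr.comp_congr (prep_comp_kern_mul (K := classicalRealist) _ _) e4.symm _).trans ((Arr.comp_mul_comp _ _ _ _ rfl rfl).symm.trans ?_)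
    exact (congrArg₂ (· * ·) (Arr.comp_eq_left (a := (1, 1)) rfl rfl)
      (prepCaus_comp_ignore (K := classicalRealist) Λ)).trans (kern_mul _ _)
  have e5 : P'.quotArr (kern classicalRealist (k.comp (marginal (functional.Mor 1 M)))) =
      P'.quotArr (kern classicalRealist ((marginal X).par (marginal (functional.Mor 1 Λ)))) := by
    refine (congrArg P'.quotArr e1.symm).trans (Eq.trans ?_ (congrArg P'.quotArr e2))
    refine (congrArg P'.quotArr (Arr.comp_assoc _ _ _ rfl rfl)).trans ?_
    refine (P'.quotArr_comp _ _ _).trans (Eq.trans ?_ (P'.quotArr_comp _ _ _).symm)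
    exact Arr.comp_congr rfl ht _
  -- Equality in the quotient becomes equality of kernels: `k` followed by marginalization is total
  -- marginalization, so each column of `k` has the mass of a point distribution.
  have e6 := P'.kernel_eq (Quotient.exact (Arr.mk_inj e5))
  intro x
  have e7 := congrArg SubDist.mass (congrFun e6 x)
  rw [show (k.comp (marginal (functional.Mor 1 M)) x).mass = (k x).mass from
    SubDist.mass_bind_of_mass_eq_one _ fun _ => SubDist.mass_pure _] at e7
  rw [e7]
  simp only [Kernel.par, marginal, Kernel.det, SubDist.pure_bind]
  exact SubDist.mass_pure _

/-- A stochastic map from states to states, with parameter in `X`, comes from random functions: the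
values at different states are drawn independently. -/
theorem exists_functional_kernel (X : FreeMonoid (Type u)) (Λ M : finiteSystems.{u})
    (k : Kernel (X * functional.Mor 1 Λ) (functional.Mor 1 M)) (hk : IsStochastic k) :
    ∃ Ξ : Kernel X (functional.Mor Λ M), IsStochastic Ξ ∧
      (Ξ.par (Kernel.det fun x => x)).comp
        (Kernel.det fun p : El (functional.Mor Λ M * functional.Mor 1 Λ) => El.single
          (functional.Caus.comp (El.value (El.snd p)) (El.value (El.fst p)))) = k := by
  -- For each `x`, `D` has as its marginal at `l` the output of `k` on the constant function `l`,
  -- evaluated at the point of `El 1`. Finiteness of `Λ` enters here.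
  have key : ∀ x : El X, ∃ D : SubDist (El Λ.1 → El M.1), D.mass = 1 ∧ ∀ l : El Λ.1,
      (D.bind fun g => SubDist.pure (g l)) =
        (k (El.join x (El.single (A := functional.Caus.Proc 1 Λ) fun _ => l))).bind fun φ =>
          SubDist.pure ((El.value φ : El 1 → El M.1) El.star) := fun x =>
    SubDist.exists_joint (El Λ.1) _ fun l =>
      (SubDist.mass_bind_of_mass_eq_one _ fun _ => SubDist.mass_pure _).trans (hk _)
  choose D hD h using key
  refine ⟨fun x => (D x).bind fun g => SubDist.pure (El.single (A := functional.Caus.Proc Λ M) g),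
    fun x => (SubDist.mass_bind_of_mass_eq_one _ fun _ => SubDist.mass_pure _).trans (hD x), ?_⟩
  funext p
  obtain ⟨x, φ, rfl⟩ := El.exists_join p
  -- Elements of `M` are turned back into functions `1 → M`. Evaluating at the point and then taking
  -- the constant function changes nothing, definitionally, since `El 1` is a unit type.
  have hx := congrArg (fun d => SubDist.bind d fun m : El M.1 =>
    SubDist.pure (El.single (A := functional.Caus.Proc 1 M) fun _ => m))
    (h x ((El.value φ : El 1 → El Λ.1) El.star))
  simp only [SubDist.bind_bind, SubDist.pure_bind] at hx
  simp only [Kernel.comp, Kernel.par, Kernel.det, El.fst_join, El.snd_join, SubDist.bind_bind,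
    SubDist.pure_bind]
  refine Eq.trans (congrArg (D x).bind (funext fun g => (SubDist.pure_bind _ _).trans ?_))
    (hx.trans (SubDist.bind_pure _))
  exact congrArg SubDist.pure (congrArg₂ (fun (φ : functional.Caus.Proc 1 Λ)
    (g : functional.Caus.Proc Λ M) => El.single (functional.Caus.comp φ g))
    (congrArg El.value (El.snd_join _ _)) (congrArg El.value (El.fst_join _ _)))

end Representation

end CausalInferential

/-! ### Construction of `Ξ` -/

open CausalInferential CausalInferential.CITerm in
theorem proposition1 {L : Laboratory.{u}} (P : (operational L).Prediction)
    (P' : classicalRealist.{u}.Prediction) (ξ : Representation P P') :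
    ∃ Ξ : ∀ A B : L.Caus.Sys,
        Kernel ((operational L).C.Mor A B) (classicalRealist.C.Mor (ξ.space A) (ξ.space B)),
      (∀ A B : L.Caus.Sys, IsStochastic (Ξ A B)) ∧
      ∀ A B : L.Caus.Sys,
        HEq (ξ.map (P.cls (know (C := (operational L).C) A B)))
          (P'.cls ((onInf (C := classicalRealist.C) (Ξ A B) (ξ.space A)).comp
            (know (C := classicalRealist.C) (ξ.space A) (ξ.space B)))) := by
  have key : ∀ A B : L.Caus.Sys, ∃ Ξ : Kernel ((operational L).C.Mor A B)
      (classicalRealist.C.Mor (ξ.space A) (ξ.space B)), IsStochastic Ξ ∧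
        HEq (ξ.map (P.cls (know (C := (operational L).C) A B)))
          (P'.cls ((onInf (C := classicalRealist.C) Ξ (ξ.space A)).comp
            (know (C := classicalRealist.C) (ξ.space A) (ξ.space B)))) := by
    intro A B
    obtain ⟨q, hq⟩ : ∃ q : P'.QuotTheory.Proc ((operational L).C.Mor A B, ξ.space A)
        (1, ξ.space B), HEq (ξ.map (P.cls (know (C := (operational L).C) A B))) q :=
      -- The image of `κ` is moved to its expected ends, which by `obj_mk` are only propositionally
      -- those given by `ξ`.
      ⟨castHom (ξ.obj_mk _ A) (ξ.obj_mk 1 B) _, (castHom_heq _ _ _).symm⟩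
    obtain ⟨t, rfl⟩ := Quotient.exists_rep q
    obtain ⟨k, hk, htk⟩ := Representation.exists_isStochastic P' _ _ _ t
      (ξ.quotArr_comp_ignore A B t (Arr.mk_eq (ξ.obj_mk _ A) (ξ.obj_mk 1 B) hq))
    obtain ⟨Ξ, hΞ, hΞk⟩ := Representation.exists_functional_kernel _ _ _ k hk
    refine ⟨Ξ, hΞ, hq.trans (heq_of_eq (Quotient.sound ?_))⟩
    -- Both diagrams act on prepared states by the same kernel `k`, which suffices for equality in
    -- the quotient.
    refine CITheory.infEquiv_of_prep_comp_eq P' (htk.trans ?_)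
    subst hΞk
    exact (CITheory.prep_comp_onInf_comp_know (K := classicalRealist) Ξ).symm
  choose Ξ hΞ h using key
  exact ⟨Ξ, hΞ, h⟩
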